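/- Theorem 4.1 (Matrix Polynomial Efron–Stein). Let $n,d$ be natural numbers, let $Z_1,\dots,Z_n$ be mutually independent random variables on a probability space, where $Z_j$ takes values in a Polish space $E_j$ (with its Borel $\sigma$-algebra), and write $Z=(Z_1,\dots,Z_n)\in\mathcal Z=\prod_j E_j$. For each $j$ let $\widetilde Z_j$ be a random variable on the same probability space with the same law as $Z_j$ and independent of $Z$, and let $Z^{(j)}=(Z_1,\dots,Z_{j-1},\widetilde Z_j,Z_{j+1},\dots,Z_n)$. Let $H:\mathcal Z\to\mathbb H^d$ be a measurable function into the space of $d\times d$ complex Hermitian matrices. Put $$X=H(Z)-\mathbb E\,H(Z),\qquad X^{(j)}=H(Z^{(j)})-\mathbb E\,H(Z),$$ and assume $\mathbb E\|X\|^2<\infty$, where $\|\cdot\|$ is the $\ell_2$ operator norm. Define the variance proxy $$V=\frac12\sum_{j=1}^n\mathbb E\big[(X-X^{(j)})^2\,\big|\,Z\big].$$ For $1\le q<\infty$ and a $d\times d$ complex matrix $B$, let $\|B\|_q=(\operatorname{tr}|B|^q)^{1/q}$ with $|B|=(B^*B)^{1/2}$ be the Schatten $q$-norm. Then for every natural number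 $p\ge 1$, $$\big(\mathbb E\|X\|_{2p}^{2p}\big)^{1/(2p)}\le\sqrt{2(2p-1)}\,\big(\mathbb E\|V\|_p^p\big)^{1/(2p)},$$ where both expectations are taken in $[0,\infty]$ (so that if the right-hand side is finite, then so is the left-hand side). -/

import Mathlib

open MeasureTheory ProbabilityTheory
open scoped MatrixOrder Matrix.Norms.L2Operator

/-- The Schatten `p`-norm `(tr |B|^p)^(1/p)`, where `|B| = (B* B)^(1/2)`, of a complex matrix, for a
finite exponent `p`. The trace of `|B|^p` is a nonnegative real number; `re` only changes its type. -/
noncomputable def schattenNorm {d : ℕ} (p : ℝ) (B : Matrix (Fin d) (Fin d) ℂ) : ℝ :=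
  ((CFC.abs B ^ p : Matrix (Fin d) (Fin d) ℂ).trace.re) ^ (1 / p)

section Setup

variable {n d : ℕ} {Ω : Type*} [MeasurableSpace Ω] {E : Fin n → Type*}

/-- The random vector `Z = (Z_1, …, Z_n)`. -/
def randomVector (Z : ∀ j, Ω → E j) (ω : Ω) : ∀ j, E j :=
  fun j => Z j ω

/-- The random vector `Z^(j)`: the coordinate `j` of `Z` is replaced by `Z'_j`. -/
def resampledVector (Z Z' : ∀ j, Ω → E j) (j : Fin n) (ω : Ω) : ∀ j, E j :=
  Function.update (randomVector Z ω) j (Z' j ω)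

/-- The function `z ↦ X(z) = H(z) - 𝔼 H(Z)`. -/
noncomputable def centeredMatrix (P : Measure Ω) (Z : ∀ j, Ω → E j)
    (H : (∀ j, E j) → Matrix (Fin d) (Fin d) ℂ) (z : ∀ j, E j) : Matrix (Fin d) (Fin d) ℂ :=
  H z - ∫ ω, H (randomVector Z ω) ∂P

/-- The variance proxy `V = (1/2) ∑ j, 𝔼[(X - X^(j))² | Z]`, where `X = X(Z)`, `X^(j) = X(Z^(j))`. -/
noncomputable def varianceProxy [∀ j, MeasurableSpace (E j)] (P : Measure Ω)
    (Z Z' : ∀ j, Ω → E j) (H : (∀ j, E j) → Matrix (Fin d) (Fin d) ℂ) (ω : Ω) :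
    Matrix (Fin d) (Fin d) ℂ :=
  (1 / 2 : ℝ) • ∑ j : Fin n,
    (P[fun ω' => (centeredMatrix P Z H (randomVector Z ω') -
        centeredMatrix P Z H (resampledVector Z Z' j ω')) ^ 2 |
      MeasurableSpace.comap (randomVector Z) MeasurableSpace.pi]) ω

end Setup

/-! Work under the product law, with p = m + 1, and let Z' be an independent copy of Z. Let Z_T
agree with Z on T and with Z' off T. Centering gives E tr X(Z)^(2m+2) = E tr X(Z)^(2m+1) (X(Z) -
X(Z')). A permutation σ telescopes the last difference into steps D = X(Z_T) - X(Z_{T \ {j}}), where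
T holds the first k + 1 values of σ and j = σ k.

Exchanging coordinate j between Z and Z' flips the sign of D and turns X into X^(j), so a step is
half of E tr (X^(2m+1) - (X^(j))^(2m+1)) D. The trace inequality `reTrace_pow_sub_pow_mul_le` splits
it, with a free weight s, into the cross moments E tr (E[(X - X^(j))² | Z] X(Z_T)^(2m)), for this T
and for the full index set (`integral_pow_mul_step_le`). At a fixed T, the cross moments sum over j
to 2 E tr V X(Z_T)^(2m). As Z_T has the law of Z, Young's trace inequality bounds this by moments of
V and X (`sum_crossMoment_le`).

In the telescoping sum, however, T varies with j. Averaging over σ repairs this: given the set of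
the first k + 1 values, σ k is uniform on it, so one step sees on average at most 1/(k+1) of the
full bound B (`sum_perm_le`). Taking s = √(n/(k+1)) and using ∑ 1/√(k+1) ≤ 2√n yields E tr X^(2m+2)
≤ B. Since B contains only the fraction m/(m+1) of the left side, that part is absorbed.

Absorption needs a finite moment of X. It comes from applying the same inequality to the bounded
scalar function min(‖X‖, R), whose proxy is at most tr V, and letting R grow
(`integrable_norm_pow_of_integrable_proxy`). -/

set_option linter.unusedSectionVars false

/-! ### Trace inequalities from double spectral expansions. -/

section TraceInequalities

open Matrix
open scoped ComplexOrder

variable {ι : Type*} [Fintype ι] [DecidableEq ι]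

/-- The real part of the trace, as a continuous real-linear functional. -/
noncomputable def reTrace (ι : Type*) [Fintype ι] [DecidableEq ι] : Matrix ι ι ℂ →L[ℝ] ℝ :=
  LinearMap.toContinuousLinearMap (Complex.reLm ∘ₗ Matrix.traceLinearMap ι ℝ ℂ)

lemma reTrace_apply (A : Matrix ι ι ℂ) : reTrace ι A = A.trace.re := rfl

lemma reTrace_mul_comm (A B : Matrix ι ι ℂ) : reTrace ι (A * B) = reTrace ι (B * A) := by
  rw [reTrace_apply, reTrace_apply, Matrix.trace_mul_comm]

/-- `U` and `a` diagonalize the matrix `A`. -/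
structure Diagonalizes (A U : Matrix ι ι ℂ) (a : ι → ℝ) : Prop where
  star_mul : star U * U = 1
  mul_star : U * star U = 1
  eq : A = U * diagonal (fun i => (a i : ℂ)) * star U

lemma Matrix.IsHermitian.exists_diagonalizes {A : Matrix ι ι ℂ} (hA : A.IsHermitian) :
    Diagonalizes A (hA.eigenvectorUnitary : Matrix ι ι ℂ) hA.eigenvalues where
  star_mul := Unitary.coe_star_mul_self _
  mul_star := Unitary.coe_mul_star_self _
  eq := by
    conv_lhs => rw [hA.spectral_theorem]
    rfl

lemma Diagonalizes.pow {A U : Matrix ι ι ℂ} {a : ι → ℝ} (h : Diagonalizes A U a) (k : ℕ) :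
    Diagonalizes (A ^ k) U (fun i => a i ^ k) := by
  refine ⟨h.star_mul, h.mul_star, ?_⟩
  induction k with
  | zero => simp [h.mul_star]
  | succ k ih =>
    have h2 : diagonal (fun i => ((a i ^ (k + 1) : ℝ) : ℂ)) =
        diagonal (fun i => ((a i ^ k : ℝ) : ℂ)) * diagonal (fun i => (a i : ℂ)) := by
      rw [diagonal_mul_diagonal]; congr 1; ext i; push_cast; ring
    rw [pow_succ, ih, h2]
    conv_lhs => rw [h.eq]
    calc _ = U * diagonal (fun i => ((a i ^ k : ℝ) : ℂ)) * (star U * U) *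
          diagonal (fun i => (a i : ℂ)) * star U := by simp only [mul_assoc]
      _ = _ := by rw [h.star_mul]; simp only [mul_assoc, one_mul]

lemma Diagonalizes.reTrace {A U : Matrix ι ι ℂ} {a : ι → ℝ} (h : Diagonalizes A U a) :
    reTrace ι A = ∑ i, a i := by
  rw [h.eq, reTrace_mul_comm, ← mul_assoc, h.star_mul, one_mul, reTrace_apply, trace_diagonal]
  simp

/-- The trace of `A D B D` in terms of the matrix of `D` with respect to eigenbases of `A`, `B`. -/
lemma reTrace_mul_mul_mul {A B D U V : Matrix ι ι ℂ} {a b : ι → ℝ} (hA : Diagonalizes A U a)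
    (hB : Diagonalizes B V b) (hD : D.IsHermitian) :
    reTrace ι (A * D * B * D) =
      ∑ i, ∑ k, a i * b k * Complex.normSq ((star U * D * V) i k) := by
  set K := star U * D * V with hK
  have hKs : star K = star V * D * U := by
    rw [hK, star_mul, star_mul, star_star, mul_assoc, show star D = D from hD]
  have : reTrace ι (A * D * B * D) = reTrace ι (diagonal (fun i => (a i : ℂ)) * K *
      diagonal (fun i => (b i : ℂ)) * star K) := by
    rw [hA.eq, hB.eq, hKs, hK]
    simp only [mul_assoc]
    rw [reTrace_mul_comm]
    simp only [mul_assoc]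
  rw [this, reTrace_apply, trace, Complex.re_sum]
  refine Finset.sum_congr rfl fun i _ => ?_
  rw [diag_apply, mul_apply, Complex.re_sum]
  refine Finset.sum_congr rfl fun k _ => ?_
  rw [mul_diagonal, diagonal_mul, star_apply, Complex.normSq_apply]
  simp
  ring

lemma Diagonalizes.one {V : Matrix ι ι ℂ} {B : Matrix ι ι ℂ} {b : ι → ℝ}
    (hB : Diagonalizes B V b) : Diagonalizes (1 : Matrix ι ι ℂ) V (fun _ => 1) := by
  simpa using hB.pow 0

lemma reTrace_mul_nonneg {A B : Matrix ι ι ℂ} (hA : A.PosSemidef) (hB : B.PosSemidef) :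
    0 ≤ reTrace ι (A * B) := by
  have h := reTrace_mul_mul_mul hA.1.exists_diagonalizes hB.1.exists_diagonalizes
    (Matrix.isHermitian_one)
  rw [mul_one, mul_one] at h
  rw [h]
  exact Finset.sum_nonneg fun i _ => Finset.sum_nonneg fun k _ => mul_nonneg
    (mul_nonneg (hA.eigenvalues_nonneg i) (hB.eigenvalues_nonneg k)) (Complex.normSq_nonneg _)

lemma reTrace_nonneg {A : Matrix ι ι ℂ} (hA : A.PosSemidef) : 0 ≤ reTrace ι A := by
  simpa using reTrace_mul_nonneg hA Matrix.PosSemidef.one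

/-- Weighted AM-GM for a^(p+1) and b^(p+1) with weights 1/(p+1) and p/(p+1). -/
lemma young_mul_pow_le {a b : ℝ} (ha : 0 ≤ a) (hb : 0 ≤ b) (p : ℕ) :
    a * b ^ p ≤ a ^ (p + 1) / (p + 1) + p / (p + 1) * b ^ (p + 1) := by
  have hp : (0 : ℝ) < p + 1 := by positivity
  have h := Real.geom_mean_le_arith_mean2_weighted (w₁ := 1 / (p + 1)) (w₂ := p / (p + 1))
    (p₁ := a ^ (p + 1)) (p₂ := b ^ (p + 1)) (by positivity) (by positivity) (by positivity)
    (by positivity) (by field_simp; ring)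
  have h1 : (a ^ (p + 1)) ^ ((1 : ℝ) / (p + 1)) = a := by
    rw [← Real.rpow_natCast, ← Real.rpow_mul ha]
    push_cast
    rw [mul_one_div_cancel hp.ne', Real.rpow_one]
  have h2 : (b ^ (p + 1)) ^ ((p : ℝ) / (p + 1)) = b ^ p := by
    rw [← Real.rpow_natCast, ← Real.rpow_mul hb, ← Real.rpow_natCast]
    congr 1
    push_cast
    field_simp
  rw [h1, h2] at h
  calc _ ≤ _ := h
    _ = _ := by ring

/-- Young's inequality for the trace. -/
lemma reTrace_young {A B : Matrix ι ι ℂ} (hA : A.PosSemidef) (hB : B.PosSemidef) (p : ℕ) :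
    reTrace ι (A * B ^ p) ≤
      reTrace ι (A ^ (p + 1)) / (p + 1) + p / (p + 1) * reTrace ι (B ^ (p + 1)) := by
  have dA := hA.1.exists_diagonalizes
  have dB := hB.1.exists_diagonalizes
  have h := reTrace_mul_mul_mul dA (dB.pow p) Matrix.isHermitian_one
  have h1 := reTrace_mul_mul_mul (dA.pow (p + 1)) dB.one Matrix.isHermitian_one
  have h2 := reTrace_mul_mul_mul dA.one (dB.pow (p + 1)) Matrix.isHermitian_one
  simp only [mul_one, one_mul] at h h1 h2
  rw [h, h1, h2, Finset.sum_div, Finset.mul_sum, ← Finset.sum_add_distrib]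
  refine Finset.sum_le_sum fun i _ => ?_
  rw [Finset.sum_div, Finset.mul_sum, ← Finset.sum_add_distrib]
  refine Finset.sum_le_sum fun k _ => ?_
  calc _ ≤ (hA.1.eigenvalues i ^ (p + 1) / (p + 1) +
        p / (p + 1) * hB.1.eigenvalues k ^ (p + 1)) * _ :=
        mul_le_mul_of_nonneg_right
          (young_mul_pow_le (hA.eigenvalues_nonneg i) (hB.eigenvalues_nonneg k) p)
          (Complex.normSq_nonneg _)
    _ = _ := by ring

/-- Pair the term l with the term n - l: x^l - y^l and x^(n-l) - y^(n-l) have the same sign, so each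
pair is at most x^n + y^n. -/
lemma two_mul_geom_sum₂_le {x y : ℝ} (hx : 0 ≤ x) (hy : 0 ≤ y) (n : ℕ) :
    2 * ∑ l ∈ Finset.range (n + 1), x ^ l * y ^ (n - l) ≤ (n + 1) * (x ^ n + y ^ n) := by
  have hr : ∑ l ∈ Finset.range (n + 1), x ^ l * y ^ (n - l) =
      ∑ l ∈ Finset.range (n + 1), x ^ (n - l) * y ^ l := by
    rw [← Finset.sum_range_reflect]
    refine Finset.sum_congr rfl fun l hl => ?_
    have : l ≤ n := Nat.lt_succ_iff.1 (Finset.mem_range.1 hl)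
    rw [show n + 1 - 1 - l = n - l by omega, show n - (n - l) = l by omega]
  calc 2 * ∑ l ∈ Finset.range (n + 1), x ^ l * y ^ (n - l) =
      ∑ l ∈ Finset.range (n + 1), (x ^ l * y ^ (n - l) + x ^ (n - l) * y ^ l) := by
        rw [Finset.sum_add_distrib, ← hr]; ring
    _ ≤ ∑ l ∈ Finset.range (n + 1), (x ^ n + y ^ n) := by
        refine Finset.sum_le_sum fun l hl => ?_
        have hl : l ≤ n := Nat.lt_succ_iff.1 (Finset.mem_range.1 hl)
        have e1 : x ^ n = x ^ l * x ^ (n - l) := by rw [← pow_add]; congr 1; omega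
        have e2 : y ^ n = y ^ l * y ^ (n - l) := by rw [← pow_add]; congr 1; omega
        have : 0 ≤ (x ^ l - y ^ l) * (x ^ (n - l) - y ^ (n - l)) := by
          rcases le_total x y with h | h
          · exact mul_nonneg_of_nonpos_of_nonpos
              (sub_nonpos.2 (pow_le_pow_left₀ hx h _)) (sub_nonpos.2 (pow_le_pow_left₀ hx h _))
          · exact mul_nonneg
              (sub_nonneg.2 (pow_le_pow_left₀ hy h _)) (sub_nonneg.2 (pow_le_pow_left₀ hy h _))
        rw [e1, e2]; nlinarith
    _ = _ := by simp [mul_add]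

lemma abs_geom_sum₂_le (a b : ℝ) (m : ℕ) :
    |∑ l ∈ Finset.range (2 * m + 1), a ^ l * b ^ (2 * m - l)| ≤
      (2 * m + 1) / 2 * (a ^ (2 * m) + b ^ (2 * m)) := by
  have h := two_mul_geom_sum₂_le (abs_nonneg a) (abs_nonneg b) (2 * m)
  have e : ∀ x : ℝ, |x| ^ (2 * m) = x ^ (2 * m) := fun x => by rw [pow_mul, pow_mul, sq_abs]
  rw [e, e] at h
  push_cast at h
  have h2 : |∑ l ∈ Finset.range (2 * m + 1), a ^ l * b ^ (2 * m - l)| ≤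
      ∑ l ∈ Finset.range (2 * m + 1), |a| ^ l * |b| ^ (2 * m - l) :=
    (Finset.abs_sum_le_sum_abs _ _).trans_eq
      (Finset.sum_congr rfl fun l _ => by rw [abs_mul, abs_pow, abs_pow])
  linarith

/-- The mean value trace inequality for odd powers. -/
lemma reTrace_pow_sub_pow_mul_le {A B C : Matrix ι ι ℂ} (hA : A.IsHermitian) (hB : B.IsHermitian)
    (hC : C.IsHermitian) (m : ℕ) {s : ℝ} (hs : 0 < s) :
    reTrace ι ((A ^ (2 * m + 1) - B ^ (2 * m + 1)) * C) ≤ (2 * m + 1) / 4 *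
      (s * (reTrace ι ((A - B) ^ 2 * A ^ (2 * m)) + reTrace ι ((A - B) ^ 2 * B ^ (2 * m))) +
        s⁻¹ * (reTrace ι (C ^ 2 * A ^ (2 * m)) + reTrace ι (C ^ 2 * B ^ (2 * m)))) := by
  have dA := hA.exists_diagonalizes
  have dB := hB.exists_diagonalizes
  set a := hA.eigenvalues
  set b := hB.eigenvalues
  set U : Matrix ι ι ℂ := (hA.eigenvectorUnitary : Matrix ι ι ℂ)
  set V : Matrix ι ι ℂ := (hB.eigenvectorUnitary : Matrix ι ι ℂ)
  -- Both quadratic terms on the right become weighted sums of squared entries between the two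
  -- eigenbases, so the inequality can be proved entry by entry.
  have key : ∀ D : Matrix ι ι ℂ, D.IsHermitian →
      reTrace ι (D ^ 2 * A ^ (2 * m)) + reTrace ι (D ^ 2 * B ^ (2 * m)) =
        ∑ i, ∑ k, (a i ^ (2 * m) + b k ^ (2 * m)) * Complex.normSq ((star U * D * V) i k) := by
    intro D hD
    have h1 := reTrace_mul_mul_mul (dA.pow (2 * m)) dB.one hD
    have h2 := reTrace_mul_mul_mul dA.one (dB.pow (2 * m)) hD
    simp only [mul_one, one_mul] at h1 h2
    rw [reTrace_mul_comm, sq, ← mul_assoc, h1, mul_assoc D D, reTrace_mul_comm D, h2,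
      ← Finset.sum_add_distrib]
    refine Finset.sum_congr rfl fun i _ => ?_
    rw [← Finset.sum_add_distrib]
    exact Finset.sum_congr rfl fun k _ => by ring
  rw [key _ (hA.sub hB), key _ hC]
  set Q := star U * V with hQ
  set K := star U * C * V with hK
  have hKs : star K = star V * C * U := by
    rw [hK, star_mul, star_mul, star_star, mul_assoc, show star C = C from hC]
  -- In these mixed bases the difference of powers and the difference itself are both multiples of
  -- `Q`; their ratio is the geometric sum `φ` below.
  have hM : ∀ i k, (star U * (A - B) * V) i k = ((a i - b k : ℝ) : ℂ) * Q i k := by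
    have : star U * (A - B) * V = diagonal (fun i => (a i : ℂ)) * Q -
        Q * diagonal (fun i => (b i : ℂ)) := by
      rw [mul_sub, sub_mul]
      conv_lhs => rw [dA.eq, dB.eq]
      congr 1
      · rw [← mul_assoc, ← mul_assoc, dA.star_mul, one_mul, hQ, mul_assoc]
      · simp only [hQ, mul_assoc]
        rw [dB.star_mul, mul_one]
    intro i k
    rw [this, Matrix.sub_apply, diagonal_mul, mul_diagonal]
    push_cast; ring
  have hL : reTrace ι ((A ^ (2 * m + 1) - B ^ (2 * m + 1)) * C) =
      ∑ i, ∑ k, (((a i ^ (2 * m + 1) - b k ^ (2 * m + 1) : ℝ) : ℂ) * Q i k * star (K i k)).re := by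
    have h1 : reTrace ι (A ^ (2 * m + 1) * C) =
        reTrace ι (diagonal (fun i => ((a i ^ (2 * m + 1) : ℝ) : ℂ)) * Q * star K) := by
      rw [hKs, hQ, (dA.pow _).eq]
      calc _ = reTrace ι (diagonal (fun i => ((a i ^ (2 * m + 1) : ℝ) : ℂ)) *
            star U * C * U) := by
            simp only [mul_assoc]; rw [reTrace_mul_comm]; simp only [mul_assoc]
        _ = reTrace ι (diagonal (fun i => ((a i ^ (2 * m + 1) : ℝ) : ℂ)) *
            star U * (V * star V) * C * U) := by rw [dB.mul_star, mul_one]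
        _ = _ := by simp only [mul_assoc]
    have h2 : reTrace ι (B ^ (2 * m + 1) * C) =
        reTrace ι (Q * diagonal (fun i => ((b i ^ (2 * m + 1) : ℝ) : ℂ)) * star K) := by
      rw [hKs, hQ, (dB.pow _).eq]
      calc _ = reTrace ι ((U * star U) * V * diagonal (fun i => ((b i ^ (2 * m + 1) : ℝ) : ℂ)) *
            star V * C) := by rw [dA.mul_star, one_mul]
        _ = _ := by
          simp only [mul_assoc]; rw [reTrace_mul_comm]; simp only [mul_assoc]
    rw [sub_mul, map_sub, h1, h2, ← map_sub, ← sub_mul, reTrace_apply, trace, Complex.re_sum]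
    refine Finset.sum_congr rfl fun i _ => ?_
    rw [diag_apply, mul_apply, Complex.re_sum]
    refine Finset.sum_congr rfl fun k _ => ?_
    rw [Matrix.sub_apply, diagonal_mul, mul_diagonal, star_apply]
    congr 2
    push_cast; ring
  rw [hL]
  simp only [mul_add, Finset.mul_sum, ← Finset.sum_add_distrib]
  refine Finset.sum_le_sum fun i _ => Finset.sum_le_sum fun k _ => ?_
  rw [hM]
  set φ := ∑ l ∈ Finset.range (2 * m + 1), a i ^ l * b k ^ (2 * m - l) with hφ
  have hgeom : a i ^ (2 * m + 1) - b k ^ (2 * m + 1) = φ * (a i - b k) :=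
    ((Commute.all (a i) (b k)).geom_sum₂_mul (2 * m + 1)).symm
  have hφle := abs_geom_sum₂_le (a i) (b k) m
  rw [← hφ] at hφle
  set M : ℂ := ((a i - b k : ℝ) : ℂ) * Q i k with hMdef
  have e : (((a i ^ (2 * m + 1) - b k ^ (2 * m + 1) : ℝ) : ℂ) * Q i k * star (K i k)) =
      (φ : ℂ) * (M * star (K i k)) := by
    rw [hgeom, hMdef]; push_cast; ring
  rw [e, Complex.re_ofReal_mul, ← Complex.sq_norm, ← Complex.sq_norm]
  have h1 : φ * (M * star (K i k)).re ≤ |φ| * (‖M‖ * ‖K i k‖) := by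
    refine (le_abs_self _).trans ?_
    rw [abs_mul]
    refine mul_le_mul_of_nonneg_left ((Complex.abs_re_le_norm _).trans_eq ?_) (abs_nonneg _)
    rw [norm_mul, norm_star]
  -- AM-GM with the free weight s, which is optimized only in the final summation.
  have h2 : ‖M‖ * ‖K i k‖ ≤ (s * ‖M‖ ^ 2 + s⁻¹ * ‖K i k‖ ^ 2) / 2 := by
    have h3 : 0 ≤ s⁻¹ * (s * ‖M‖ - ‖K i k‖) ^ 2 := by positivity
    have h4 : s⁻¹ * (s * ‖M‖ - ‖K i k‖) ^ 2 =
        s * ‖M‖ ^ 2 + s⁻¹ * ‖K i k‖ ^ 2 - 2 * (‖M‖ * ‖K i k‖) := by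
      field_simp; ring
    linarith
  calc _ ≤ |φ| * (‖M‖ * ‖K i k‖) := h1
    _ ≤ ((2 * m + 1) / 2 * (a i ^ (2 * m) + b k ^ (2 * m))) *
        ((s * ‖M‖ ^ 2 + s⁻¹ * ‖K i k‖ ^ 2) / 2) :=
        mul_le_mul hφle h2 (by positivity) ((abs_nonneg _).trans hφle)
    _ = _ := by ring

lemma norm_le_reTrace {A : Matrix ι ι ℂ} (hA : A.PosSemidef) : ‖A‖ ≤ reTrace ι A := by
  have dA := hA.1.exists_diagonalizes
  have h1 : ‖A‖ = ‖diagonal (fun i => (hA.1.eigenvalues i : ℂ))‖ := by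
    conv_lhs => rw [dA.eq]
    rw [CStarRing.norm_mul_mem_unitary _ (Unitary.star_mem hA.1.eigenvectorUnitary.2),
      CStarRing.norm_mem_unitary_mul _ hA.1.eigenvectorUnitary.2]
  rw [h1, Matrix.l2_opNorm_diagonal, dA.reTrace]
  refine (pi_norm_le_iff_of_nonneg (Finset.sum_nonneg fun i _ => hA.eigenvalues_nonneg i)).2
    fun i => ?_
  rw [Complex.norm_real, Real.norm_of_nonneg (hA.eigenvalues_nonneg i)]
  exact Finset.single_le_sum (f := hA.1.eigenvalues) (fun i _ => hA.eigenvalues_nonneg i)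
    (Finset.mem_univ i)

lemma Matrix.IsHermitian.posSemidef_sq {A : Matrix ι ι ℂ} (hA : A.IsHermitian) :
    (A ^ 2).PosSemidef := by
  rw [sq]; nth_rw 1 [← hA.eq]; exact Matrix.posSemidef_conjTranspose_mul_self A

lemma Matrix.IsHermitian.posSemidef_pow_two_mul {A : Matrix ι ι ℂ} (hA : A.IsHermitian) (k : ℕ) :
    (A ^ (2 * k)).PosSemidef := by
  rw [pow_mul]; exact hA.posSemidef_sq.pow k

lemma sq_norm_le_reTrace_sq {A : Matrix ι ι ℂ} (hA : A.IsHermitian) :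
    ‖A‖ ^ 2 ≤ reTrace ι (A ^ 2) := by
  refine le_trans (le_of_eq ?_) (norm_le_reTrace hA.posSemidef_sq)
  rw [sq, sq, ← CStarRing.norm_star_mul_self, show star A = A from hA]

/-- Power mean inequality on the eigenvalues. It lets a moment of tr V be dominated by a moment of V
in the truncation argument. -/
lemma reTrace_pow_le {A : Matrix ι ι ℂ} (hA : A.PosSemidef) (p : ℕ) :
    reTrace ι A ^ (p + 1) ≤ (Fintype.card ι : ℝ) ^ p * reTrace ι (A ^ (p + 1)) := by
  have dA := hA.1.exists_diagonalizes
  rw [dA.reTrace, (dA.pow _).reTrace]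
  exact pow_sum_le_card_mul_sum_pow (fun i _ => hA.eigenvalues_nonneg i) p
end TraceInequalities

/-! ### Exchanging and resampling coordinates under product measures. -/

section ProductMeasures

variable {κ : Type*} [Fintype κ] {E : κ → Type*} [∀ j, MeasurableSpace (E j)]
  (μ : ∀ j, Measure (E j)) [∀ j, IsProbabilityMeasure (μ j)]

lemma pi_prod_pi_eq {ρ : Measure ((∀ j, E j) × (∀ j, E j))}
    (h : ∀ s t : ∀ j, Set (E j), (∀ j, MeasurableSet (s j)) → (∀ j, MeasurableSet (t j)) →
      ρ (Set.univ.pi s ×ˢ Set.univ.pi t) = (∏ j, μ j (s j)) * ∏ j, μ j (t j)) :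
    (Measure.pi μ).prod (Measure.pi μ) = ρ := by
  have hs : (Measure.pi μ).FiniteSpanningSetsIn
      (Set.univ.pi '' Set.univ.pi fun i => {s : Set (E i) | MeasurableSet s}) :=
    { set := fun _ => Set.univ
      set_mem := fun _ => ⟨fun _ => Set.univ, fun _ _ => MeasurableSet.univ, Set.pi_univ _⟩
      finite := fun _ => by simp
      spanning := Set.iUnion_const _ }
  refine Measure.prod_eq_generateFrom generateFrom_pi generateFrom_pi isPiSystem_pi isPiSystem_pi
    hs hs ?_
  rintro _ ⟨s, hs, rfl⟩ _ ⟨t, ht, rfl⟩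
  rw [h s t (fun j => hs j trivial) (fun j => ht j trivial), Measure.pi_pi, Measure.pi_pi]

variable [DecidableEq κ]

/-- Exchange the coordinates in `S` of two vectors. -/
def swapOn (S : Finset κ) (x : (∀ j, E j) × (∀ j, E j)) : (∀ j, E j) × (∀ j, E j) :=
  (S.piecewise x.2 x.1, S.piecewise x.1 x.2)

lemma measurable_piecewise_pair (S : Finset κ) :
    Measurable fun x : (∀ j, E j) × (∀ j, E j) => S.piecewise x.1 x.2 := by
  refine measurable_pi_lambda _ fun j => ?_
  by_cases hj : j ∈ S
  · simpa [hj, Function.comp_def] using (measurable_pi_apply j).comp measurable_fst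
  · simpa [hj, Function.comp_def] using (measurable_pi_apply j).comp measurable_snd

lemma measurable_swapOn (S : Finset κ) : Measurable (swapOn (E := E) S) :=
  ((measurable_piecewise_pair S).comp measurable_swap).prodMk (measurable_piecewise_pair S)

/-- Exchangeability of the two copies: the preimage of a product of boxes is again one, with the
sides in S interchanged, and such products determine the measure. -/
lemma measurePreserving_swapOn (S : Finset κ) :
    MeasurePreserving (swapOn S) ((Measure.pi μ).prod (Measure.pi μ))
      ((Measure.pi μ).prod (Measure.pi μ)) := by
  refine ⟨measurable_swapOn S, (pi_prod_pi_eq μ fun s t hs ht => ?_).symm⟩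
  rw [Measure.map_apply (measurable_swapOn S)
    ((MeasurableSet.univ_pi hs).prod (MeasurableSet.univ_pi ht))]
  have : swapOn S ⁻¹' (Set.univ.pi s ×ˢ Set.univ.pi t) =
      Set.univ.pi (S.piecewise t s) ×ˢ Set.univ.pi (S.piecewise s t) := by
    ext x
    simp only [Set.mem_preimage, Set.mem_prod, Set.mem_univ_pi, swapOn, ← forall_and]
    refine forall_congr' fun j => ?_
    by_cases hj : j ∈ S <;> simp [hj, and_comm]
  rw [this, Measure.prod_prod, Measure.pi_pi, Measure.pi_pi, ← Finset.prod_mul_distrib,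
    ← Finset.prod_mul_distrib]
  refine Finset.prod_congr rfl fun j _ => ?_
  by_cases hj : j ∈ S <;> simp [hj, mul_comm]

lemma measurable_update_pair (j : κ) :
    Measurable fun x : (∀ j, E j) × E j => Function.update x.1 j x.2 := by
  refine measurable_pi_lambda _ fun i => ?_
  by_cases hi : i = j
  · subst hi; simpa using measurable_snd
  · simpa [hi, Function.comp_def] using (measurable_pi_apply i).comp measurable_fst

lemma measurePreserving_update (j : κ) :
    MeasurePreserving (fun x : (∀ j, E j) × E j => Function.update x.1 j x.2)
      ((Measure.pi μ).prod (μ j)) (Measure.pi μ) := by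
  refine ⟨measurable_update_pair j, (Measure.pi_eq fun s hs => ?_).symm⟩
  rw [Measure.map_apply (measurable_update_pair j) (MeasurableSet.univ_pi hs)]
  have : (fun x : (∀ j, E j) × E j => Function.update x.1 j x.2) ⁻¹' Set.univ.pi s =
      Set.univ.pi (Function.update s j Set.univ) ×ˢ s j := by
    ext x
    simp only [Set.mem_preimage, Set.mem_prod, Set.mem_univ_pi]
    constructor
    · intro h
      refine ⟨fun i => ?_, by simpa using h j⟩
      by_cases hi : i = j
      · subst hi; simp
      · simpa [hi] using h i
    · rintro ⟨h1, h2⟩ i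
      by_cases hi : i = j
      · subst hi; simpa using h2
      · simpa [hi] using h1 i
  rw [this, Measure.prod_prod, Measure.pi_pi, ← Finset.mul_prod_erase _ _ (Finset.mem_univ j),
    ← Finset.mul_prod_erase Finset.univ (fun i => μ i (s i)) (Finset.mem_univ j), mul_comm]
  simp only [Function.update_self, measure_univ, one_mul]
  congr 1
  refine Finset.prod_congr rfl fun i hi => ?_
  rw [Function.update_of_ne (Finset.ne_of_mem_erase hi)]

lemma measurePreserving_piecewise (S : Finset κ) :
    MeasurePreserving (fun x : (∀ j, E j) × (∀ j, E j) => S.piecewise x.1 x.2)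
      ((Measure.pi μ).prod (Measure.pi μ)) (Measure.pi μ) :=
  measurePreserving_snd.comp (measurePreserving_swapOn μ S)

end ProductMeasures

/-! ### Conditioning on one of two independent variables. -/

section ConditionalExpectation

variable {Ω α β F : Type*} [MeasurableSpace Ω] [MeasurableSpace α] [MeasurableSpace β]
  [NormedAddCommGroup F] [NormedSpace ℝ F] [CompleteSpace F]

/-- If `X` and `Y` are independent, conditioning on `X` integrates out `Y`. -/
lemma condExp_comap_ae_eq_integral {P : Measure Ω} [IsProbabilityMeasure P]
    {μ : Measure α} {ν : Measure β} [IsProbabilityMeasure μ] [IsProbabilityMeasure ν]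
    {X : Ω → α} {Y : Ω → β} (hX : MeasurePreserving X P μ)
    (hXY : MeasurePreserving (fun ω => (X ω, Y ω)) P (μ.prod ν))
    {f : α × β → F} (hf : Integrable f (μ.prod ν)) (hfm : StronglyMeasurable f) :
    P[fun ω => f (X ω, Y ω) | MeasurableSpace.comap X inferInstance] =ᵐ[P]
      fun ω => ∫ y, f (X ω, y) ∂ν := by
  have hg : StronglyMeasurable fun x => ∫ y, f (x, y) ∂ν := hfm.integral_prod_right'
  have hgi : Integrable (fun x => ∫ y, f (x, y) ∂ν) μ := hf.integral_prod_left
  have hm : MeasurableSpace.comap X inferInstance ≤ (inferInstance : MeasurableSpace Ω) :=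
    hX.measurable.comap_le
  refine (ae_eq_condExp_of_forall_setIntegral_eq hm
    (hXY.integrable_comp_of_integrable hf) (fun s _ _ =>
      (hX.integrable_comp_of_integrable hgi).integrableOn) ?_ ?_).symm
  -- An event of the conditioning σ-algebra is `X ⁻¹' s`; pushed to the product space it is s ×
  -- univ, where Fubini applies.
  · rintro _ ⟨s, hs, rfl⟩ _
    have h1 : ∫ ω in X ⁻¹' s, (fun x => ∫ y, f (x, y) ∂ν) (X ω) ∂P =
        ∫ x in s, ∫ y, f (x, y) ∂ν ∂μ := by
      rw [← hX.map_eq, setIntegral_map hs (hX.map_eq ▸ hg.aestronglyMeasurable)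
        hX.measurable.aemeasurable]
    have h2 : ∫ ω in X ⁻¹' s, f (X ω, Y ω) ∂P = ∫ x in s ×ˢ Set.univ, f x ∂(μ.prod ν) := by
      rw [← hXY.map_eq, setIntegral_map (hs.prod MeasurableSet.univ)
        (hXY.map_eq ▸ hfm.aestronglyMeasurable) hXY.measurable.aemeasurable]
      congr 2
      ext ω; simp
    refine h1.trans (Eq.trans ?_ h2.symm)
    rw [setIntegral_prod _ hf.integrableOn]
    simp
  · exact (hg.comp_measurable (comap_measurable X)).aestronglyMeasurable

end ConditionalExpectation

/-! ### Integrability of powers of norms. -/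

section PowerIntegrability

variable {α F G : Type*} [MeasurableSpace α] {ν : Measure α} [NormedAddCommGroup F]
  [NormedAddCommGroup G]

lemma pow_mul_pow_le_pow_add_pow {a b : ℝ} (ha : 0 ≤ a) (hb : 0 ≤ b) (k l : ℕ) :
    a ^ k * b ^ l ≤ a ^ (k + l) + b ^ (k + l) := by
  rcases le_total a b with h | h
  · calc a ^ k * b ^ l ≤ b ^ k * b ^ l := by gcongr
      _ = b ^ (k + l) := (pow_add _ _ _).symm
      _ ≤ _ := by linarith [pow_nonneg ha (k + l)]
  · calc a ^ k * b ^ l ≤ a ^ k * a ^ l := by gcongr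
      _ = a ^ (k + l) := (pow_add _ _ _).symm
      _ ≤ _ := by linarith [pow_nonneg hb (k + l)]

lemma integrable_norm_pow_mul_norm_pow {f : α → F} {g : α → G}
    (hf : AEStronglyMeasurable f ν) (hg : AEStronglyMeasurable g ν) {k l N : ℕ} (hN : k + l = N)
    (hfi : Integrable (fun x => ‖f x‖ ^ N) ν) (hgi : Integrable (fun x => ‖g x‖ ^ N) ν) :
    Integrable (fun x => ‖f x‖ ^ k * ‖g x‖ ^ l) ν := by
  subst hN
  refine (hfi.add hgi).mono' ((hf.norm.pow k).mul (hg.norm.pow l)) (ae_of_all _ fun x => ?_)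
  rw [Real.norm_of_nonneg (by positivity)]
  exact pow_mul_pow_le_pow_add_pow (norm_nonneg _) (norm_nonneg _) k l

lemma integrable_norm_pow_of_exponent_le [IsFiniteMeasure ν] {f : α → F} (hf : AEStronglyMeasurable f ν)
    {k N : ℕ} (hk : k ≤ N) (hfi : Integrable (fun x => ‖f x‖ ^ N) ν) :
    Integrable (fun x => ‖f x‖ ^ k) ν := by
  have := integrable_norm_pow_mul_norm_pow (ν := ν) hf
    (aestronglyMeasurable_const (b := (1 : ℝ))) (Nat.add_sub_cancel' hk) hfi (by simp)
  simpa using this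

lemma integrable_norm_add_pow {f g : α → F}
    (hf : AEStronglyMeasurable f ν) (hg : AEStronglyMeasurable g ν) (N : ℕ)
    (hfi : Integrable (fun x => ‖f x‖ ^ N) ν) (hgi : Integrable (fun x => ‖g x‖ ^ N) ν) :
    Integrable (fun x => ‖f x + g x‖ ^ N) ν := by
  refine ((hfi.add hgi).const_mul (2 ^ N)).mono' ((hf.add hg).norm.pow N)
    (ae_of_all _ fun x => ?_)
  rw [Real.norm_of_nonneg (by positivity)]
  calc ‖f x + g x‖ ^ N ≤ (2 * max ‖f x‖ ‖g x‖) ^ N := by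
        gcongr
        linarith [norm_add_le (f x) (g x), le_max_left ‖f x‖ ‖g x‖, le_max_right ‖f x‖ ‖g x‖]
    _ ≤ 2 ^ N * (‖f x‖ ^ N + ‖g x‖ ^ N) := by
        rw [mul_pow]
        gcongr
        rcases max_choice ‖f x‖ ‖g x‖ with h | h <;> rw [h]
        · linarith [pow_nonneg (norm_nonneg (g x)) N]
        · linarith [pow_nonneg (norm_nonneg (f x)) N]

end PowerIntegrability

/-! ### Integrability of matrix monomials. -/

section MatrixIntegrability

variable {ι : Type*} [Fintype ι] [DecidableEq ι] {α β : Type*} [MeasurableSpace α]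
  [MeasurableSpace β] {ν : Measure α} {π : Measure β}

lemma integral_comp_of_stronglyMeasurable {F : Type*} [NormedAddCommGroup F] [NormedSpace ℝ F]
    {φ : α → β} (h : MeasurePreserving φ ν π) {f : β → F} (hf : StronglyMeasurable f) :
    ∫ x, f (φ x) ∂ν = ∫ y, f y ∂π := by
  rw [← h.map_eq, integral_map h.measurable.aemeasurable hf.aestronglyMeasurable]

/-- The constant serves only k = 0, where the left side is the norm of the identity. -/
lemma Matrix.norm_pow_le_const_mul (A : Matrix ι ι ℂ) (k : ℕ) :
    ‖A ^ k‖ ≤ max 1 ‖(1 : Matrix ι ι ℂ)‖ * ‖A‖ ^ k := by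
  rcases Nat.eq_zero_or_pos k with rfl | hk
  · simp
  · calc ‖A ^ k‖ ≤ 1 * ‖A‖ ^ k := by rw [one_mul]; exact norm_pow_le' A hk
      _ ≤ _ := by gcongr; exact le_max_left _ _

lemma integrable_matrix_pow_mul_pow {f g : α → Matrix ι ι ℂ} (hf : StronglyMeasurable f)
    (hg : StronglyMeasurable g) {k l N : ℕ} (hN : k + l = N)
    (hfi : Integrable (fun x => ‖f x‖ ^ N) ν) (hgi : Integrable (fun x => ‖g x‖ ^ N) ν) :
    Integrable (fun x => f x ^ k * g x ^ l) ν := by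
  set C := max 1 ‖(1 : Matrix ι ι ℂ)‖
  have hC : 0 ≤ C := zero_le_one.trans (le_max_left _ _)
  refine ((integrable_norm_pow_mul_norm_pow hf.aestronglyMeasurable hg.aestronglyMeasurable hN
    hfi hgi).const_mul (C * C)).mono' ((hf.pow k).mul (hg.pow l)).aestronglyMeasurable
    (ae_of_all _ fun x => ?_)
  calc ‖f x ^ k * g x ^ l‖ ≤ ‖f x ^ k‖ * ‖g x ^ l‖ := norm_mul_le _ _
    _ ≤ (C * ‖f x‖ ^ k) * (C * ‖g x‖ ^ l) :=
        mul_le_mul (Matrix.norm_pow_le_const_mul _ _) (Matrix.norm_pow_le_const_mul _ _)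
          (norm_nonneg _) (by positivity)
    _ = _ := by ring

lemma integrable_matrix_pow {f : α → Matrix ι ι ℂ} (hf : StronglyMeasurable f) {k : ℕ}
    (hfi : Integrable (fun x => ‖f x‖ ^ k) ν) : Integrable (fun x => f x ^ k) ν := by
  simpa using integrable_matrix_pow_mul_pow hf hf (add_zero k) hfi hfi

lemma stronglyMeasurable_reTrace_pow {f : α → Matrix ι ι ℂ} (hf : StronglyMeasurable f) (k : ℕ) :
    StronglyMeasurable fun x => reTrace ι (f x ^ k) :=
  (reTrace ι).continuous.comp_stronglyMeasurable (hf.pow k)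

lemma integrable_norm_sub_pow {f g : α → Matrix ι ι ℂ} (hf : StronglyMeasurable f)
    (hg : StronglyMeasurable g) {N : ℕ}
    (hfi : Integrable (fun x => ‖f x‖ ^ N) ν) (hgi : Integrable (fun x => ‖g x‖ ^ N) ν) :
    Integrable (fun x => ‖f x - g x‖ ^ N) ν := by
  simpa [sub_eq_add_neg] using integrable_norm_add_pow hf.aestronglyMeasurable
    hg.neg.aestronglyMeasurable N hfi (by simpa using hgi)

end MatrixIntegrability

/-! ### Resampling one coordinate: cross moments and the one-step bound. -/

section Resampling

open scoped ComplexOrder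

variable {ι : Type*} [Fintype ι] [DecidableEq ι]
  {κ : Type*} [Fintype κ] [DecidableEq κ] {E : κ → Type*} [∀ j, MeasurableSpace (E j)]
  (μ : ∀ j, Measure (E j)) [∀ j, IsProbabilityMeasure (μ j)]
  {X : (∀ j, E j) → Matrix ι ι ℂ}

/-- The conditional mean square `𝔼[(X - X^(j))² | Z = z]` of the change caused by resampling the
coordinate `j` according to `μ j`. -/
noncomputable def resampleSq (X : (∀ j, E j) → Matrix ι ι ℂ) (j : κ) (z : ∀ j, E j) :
    Matrix ι ι ℂ :=
  ∫ y, (X z - X (Function.update z j y)) ^ 2 ∂μ j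

/-- The variance proxy as a function of the sample point. -/
noncomputable def pointProxy (X : (∀ j, E j) → Matrix ι ι ℂ) (z : ∀ j, E j) : Matrix ι ι ℂ :=
  (1 / 2 : ℝ) • ∑ j, resampleSq μ X j z

lemma stronglyMeasurable_resampleSq (hX : StronglyMeasurable X) (j : κ) :
    StronglyMeasurable (resampleSq μ X j) := by
  refine StronglyMeasurable.integral_prod_right'
    (f := fun x : (∀ j, E j) × E j => (X x.1 - X (Function.update x.1 j x.2)) ^ 2) ?_
  exact ((hX.comp_measurable measurable_fst).sub
    (hX.comp_measurable (measurable_update_pair j))).pow 2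

lemma stronglyMeasurable_pointProxy (hX : StronglyMeasurable X) :
    StronglyMeasurable (pointProxy μ X) := by
  have : StronglyMeasurable fun z => ∑ j, resampleSq μ X j z :=
    Finset.stronglyMeasurable_fun_sum _ fun j _ => stronglyMeasurable_resampleSq μ hX j
  exact this.const_smul (1 / 2 : ℝ)

/-- Valid at every z, even without integrability, since the integral then defaults to 0. -/
lemma posSemidef_resampleSq (hH : ∀ z, (X z).IsHermitian) (j : κ) (z : ∀ j, E j) :
    (resampleSq μ X j z).PosSemidef := by
  rw [← Matrix.nonneg_iff_posSemidef]
  exact integral_nonneg fun y =>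
    Matrix.nonneg_iff_posSemidef.2 ((hH z).sub (hH _)).posSemidef_sq

lemma posSemidef_pointProxy (hH : ∀ z, (X z).IsHermitian) (z : ∀ j, E j) :
    (pointProxy μ X z).PosSemidef := by
  rw [← Matrix.nonneg_iff_posSemidef]
  exact smul_nonneg (by norm_num) (Finset.sum_nonneg fun j _ =>
    Matrix.nonneg_iff_posSemidef.2 (posSemidef_resampleSq μ hH j z))

/-- Apply the exchange of the coordinate `j` to the first vector. -/
lemma swapOn_singleton_fst (j : κ) (x : (∀ j, E j) × (∀ j, E j)) :
    (swapOn {j} x).1 = Function.update x.1 j (x.2 j) := by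
  ext i
  by_cases hi : i = j
  · subst hi; simp [swapOn]
  · simp [swapOn, hi]

lemma swapOn_swapOn (S : Finset κ) (x : (∀ j, E j) × (∀ j, E j)) : swapOn S (swapOn S x) = x := by
  refine Prod.ext ?_ ?_ <;> ext i <;> by_cases hi : i ∈ S <;> simp [swapOn, hi]

/-- With `erase_piecewise_swapOn_singleton`: exchanging coordinate j interchanges the two endpoints
of an interpolation step, so their difference changes sign. -/
lemma piecewise_swapOn_singleton {T : Finset κ} {j : κ} (hj : j ∈ T)
    (x : (∀ j, E j) × (∀ j, E j)) :
    T.piecewise (swapOn {j} x).1 (swapOn {j} x).2 = (T.erase j).piecewise x.1 x.2 := by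
  ext i
  by_cases hi : i = j
  · subst hi; simp [swapOn, hj]
  · by_cases hT : i ∈ T <;> simp [swapOn, hi, hT]

lemma erase_piecewise_swapOn_singleton {T : Finset κ} {j : κ} (hj : j ∈ T)
    (x : (∀ j, E j) × (∀ j, E j)) :
    (T.erase j).piecewise (swapOn {j} x).1 (swapOn {j} x).2 = T.piecewise x.1 x.2 := by
  rw [← piecewise_swapOn_singleton hj, swapOn_swapOn]

lemma swapOn_compl_fst (T : Finset κ) (x : (∀ j, E j) × (∀ j, E j)) :
    (swapOn Tᶜ x).1 = T.piecewise x.1 x.2 := by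
  ext i
  by_cases hi : i ∈ T <;> simp [swapOn, hi]

lemma piecewise_swapOn_compl (T : Finset κ) (x : (∀ j, E j) × (∀ j, E j)) :
    T.piecewise (swapOn Tᶜ x).1 (swapOn Tᶜ x).2 = x.1 := by
  rw [← swapOn_compl_fst, swapOn_swapOn]

/-- Exchanging off T carries Z_T to Z and Z_{T \ {j}} to Z^(j), which turns a step of the
interpolation into a single resampling. -/
lemma erase_piecewise_swapOn_compl {T : Finset κ} {j : κ} (hj : j ∈ T)
    (x : (∀ j, E j) × (∀ j, E j)) :
    (T.erase j).piecewise (swapOn Tᶜ x).1 (swapOn Tᶜ x).2 = Function.update x.1 j (x.2 j) := by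
  ext i
  by_cases hi : i = j
  · subst hi; simp [swapOn, hj]
  · by_cases hT : i ∈ T <;> simp [swapOn, hi, hT]

/-- Resampling the coordinate `j` of the second vector preserves the law of the pair. -/
lemma measurePreserving_resample_snd (j : κ) :
    MeasurePreserving
      (fun x : ((∀ j, E j) × (∀ j, E j)) × E j => (x.1.1, Function.update x.1.2 j x.2))
      (((Measure.pi μ).prod (Measure.pi μ)).prod (μ j))
      ((Measure.pi μ).prod (Measure.pi μ)) :=
  ((MeasurePreserving.id (Measure.pi μ)).prod (measurePreserving_update μ j)).comp
    (measurePreserving_prodAssoc (Measure.pi μ) (Measure.pi μ) (μ j))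

lemma measurePreserving_update_fst (j : κ) :
    MeasurePreserving
      (fun x : ((∀ j, E j) × (∀ j, E j)) × E j => Function.update x.1.1 j x.2)
      (((Measure.pi μ).prod (Measure.pi μ)).prod (μ j)) (Measure.pi μ) :=
  (measurePreserving_update μ j).comp (measurePreserving_fst.prod (MeasurePreserving.id (μ j)))

section

variable {α : Type*} [MeasurableSpace α] {ν : Measure α} {m : ℕ}

lemma integrable_sub_sq_mul_pow {φ ψ χ : α → ∀ j, E j}
    (hX : StronglyMeasurable X)
    (hint : Integrable (fun z => ‖X z‖ ^ (2 * m + 2)) (Measure.pi μ))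
    (hφ : MeasurePreserving φ ν (Measure.pi μ)) (hψ : MeasurePreserving ψ ν (Measure.pi μ))
    (hχ : MeasurePreserving χ ν (Measure.pi μ)) :
    Integrable (fun x => (X (φ x) - X (ψ x)) ^ 2 * X (χ x) ^ (2 * m)) ν :=
  integrable_matrix_pow_mul_pow
    ((hX.comp_measurable hφ.measurable).sub (hX.comp_measurable hψ.measurable))
    (hX.comp_measurable hχ.measurable) (by ring)
    (integrable_norm_sub_pow (hX.comp_measurable hφ.measurable)
      (hX.comp_measurable hψ.measurable) (hφ.integrable_comp_of_integrable hint)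
      (hψ.integrable_comp_of_integrable hint))
    (hχ.integrable_comp_of_integrable hint)

lemma integrable_pow_mul {φ ψ : α → ∀ j, E j}
    (hX : StronglyMeasurable X)
    (hint : Integrable (fun z => ‖X z‖ ^ (2 * m + 2)) (Measure.pi μ))
    (hφ : MeasurePreserving φ ν (Measure.pi μ)) (hψ : MeasurePreserving ψ ν (Measure.pi μ)) :
    Integrable (fun x => X (φ x) ^ (2 * m + 1) * X (ψ x)) ν := by
  have := integrable_matrix_pow_mul_pow (ν := ν) (hX.comp_measurable hφ.measurable)
    (hX.comp_measurable hψ.measurable) (k := 2 * m + 1) (l := 1) rfl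
    (hφ.integrable_comp_of_integrable hint) (hψ.integrable_comp_of_integrable hint)
  simpa using this

end

variable {m : ℕ} (hX : StronglyMeasurable X) (hH : ∀ z, (X z).IsHermitian)
  (hint : Integrable (fun z => ‖X z‖ ^ (2 * m + 2)) (Measure.pi μ))

include hX hint in
lemma integrable_resample_mul (j : κ) (T : Finset κ) :
    Integrable (fun x : ((∀ j, E j) × (∀ j, E j)) × E j =>
      (X x.1.1 - X (Function.update x.1.1 j x.2)) ^ 2 * X (T.piecewise x.1.1 x.1.2) ^ (2 * m))
      (((Measure.pi μ).prod (Measure.pi μ)).prod (μ j)) :=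
  integrable_sub_sq_mul_pow μ hX hint (measurePreserving_fst.comp measurePreserving_fst)
    (measurePreserving_update_fst μ j)
    ((measurePreserving_piecewise μ T).comp measurePreserving_fst)

include hX hint in
lemma ae_integrable_resample_sq (j : κ) :
    ∀ᵐ z ∂Measure.pi μ, Integrable (fun y => (X z - X (Function.update z j y)) ^ 2) (μ j) := by
  have h2 : Integrable (fun z => ‖X z‖ ^ 2) (Measure.pi μ) :=
    integrable_norm_pow_of_exponent_le hX.aestronglyMeasurable (by omega) hint
  have := integrable_sub_sq_mul_pow (m := 0) μ hX (by simpa using h2)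
    (measurePreserving_fst (μ := Measure.pi μ) (ν := μ j)) (measurePreserving_update μ j)
    measurePreserving_fst
  simpa using this.prod_right_ae

include hX hint in
lemma ae_integral_resample_mul (j : κ) (T : Finset κ) :
    (fun x : (∀ j, E j) × (∀ j, E j) => ∫ y, (X x.1 - X (Function.update x.1 j y)) ^ 2 *
        X (T.piecewise x.1 x.2) ^ (2 * m) ∂μ j) =ᵐ[(Measure.pi μ).prod (Measure.pi μ)]
      fun x => resampleSq μ X j x.1 * X (T.piecewise x.1 x.2) ^ (2 * m) := by
  have h := (measurePreserving_fst (μ := Measure.pi μ) (ν := Measure.pi μ)).quasiMeasurePreserving.ae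
    (ae_integrable_resample_sq μ hX hint j)
  filter_upwards [h] with x hx
  exact integral_mul_const_of_integrable hx

include hX hint in
lemma integrable_resampleSq_mul (j : κ) (T : Finset κ) :
    Integrable (fun x : (∀ j, E j) × (∀ j, E j) =>
      resampleSq μ X j x.1 * X (T.piecewise x.1 x.2) ^ (2 * m))
      ((Measure.pi μ).prod (Measure.pi μ)) :=
  (integrable_resample_mul μ hX hint j T).integral_prod_left.congr
    (ae_integral_resample_mul μ hX hint j T)

include hX hint in
-- As j ∈ T, the factor X(Z_T) ignores coordinate j of the second vector. That coordinate can be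
-- drawn afresh and integrated out of the first factor alone.
lemma integral_update_sq_mul {j : κ} {T : Finset κ} (hj : j ∈ T) :
    ∫ x : (∀ j, E j) × (∀ j, E j), (X x.1 - X (Function.update x.1 j (x.2 j))) ^ 2 *
        X (T.piecewise x.1 x.2) ^ (2 * m) ∂(Measure.pi μ).prod (Measure.pi μ) =
      ∫ x : (∀ j, E j) × (∀ j, E j), resampleSq μ X j x.1 *
        X (T.piecewise x.1 x.2) ^ (2 * m) ∂(Measure.pi μ).prod (Measure.pi μ) := by
  have hmeas : StronglyMeasurable fun x : (∀ j, E j) × (∀ j, E j) =>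
      (X x.1 - X (Function.update x.1 j (x.2 j))) ^ 2 * X (T.piecewise x.1 x.2) ^ (2 * m) := by
    refine (((hX.comp_measurable measurable_fst).sub ?_).pow 2).mul
      ((hX.comp_measurable (measurable_piecewise_pair T)).pow _)
    refine hX.comp_measurable ((measurable_update_pair j).comp
      (measurable_fst.prodMk ((measurable_pi_apply j).comp measurable_snd)))
  rw [← integral_comp_of_stronglyMeasurable (measurePreserving_resample_snd μ j) hmeas,
    ← integral_congr_ae (ae_integral_resample_mul μ hX hint j T),
    ← integral_prod _ (integrable_resample_mul μ hX hint j T)]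
  refine integral_congr_ae (ae_of_all _ fun x => ?_)
  have : T.piecewise x.1.1 (Function.update x.1.2 j x.2) = T.piecewise x.1.1 x.1.2 := by
    ext i
    by_cases hi : i ∈ T
    · simp [hi]
    · have : i ≠ j := fun h => hi (h ▸ hj)
      simp [hi, this]
  simp [this]

/-- The expectation of `tr (𝔼[(X - X^(j))² | Z] X(Z_T)^(2m))`, where `Z_T` agrees with `Z` on `T`
and with an independent copy of `Z` off `T`. -/
noncomputable def crossMoment (m : ℕ) (X : (∀ j, E j) → Matrix ι ι ℂ) (j : κ) (T : Finset κ) : ℝ :=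
  ∫ x : (∀ j, E j) × (∀ j, E j),
    reTrace ι (resampleSq μ X j x.1 * X (T.piecewise x.1 x.2) ^ (2 * m))
      ∂(Measure.pi μ).prod (Measure.pi μ)

include hH in
lemma crossMoment_nonneg (j : κ) (T : Finset κ) : 0 ≤ crossMoment μ m X j T :=
  integral_nonneg fun _ => reTrace_mul_nonneg (posSemidef_resampleSq μ hH _ _)
    ((hH _).posSemidef_pow_two_mul m)

include hX hint in
lemma integral_update_sq_mul_eq_crossMoment (j : κ) :
    ∫ x : (∀ j, E j) × (∀ j, E j), reTrace ι ((X x.1 - X (Function.update x.1 j (x.2 j))) ^ 2 *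
        X x.1 ^ (2 * m)) ∂(Measure.pi μ).prod (Measure.pi μ) =
      crossMoment μ m X j Finset.univ := by
  have h := integral_update_sq_mul μ hX hint (Finset.mem_univ j)
  simp only [Finset.piecewise_univ] at h
  have e := measurePreserving_swapOn μ {j}
  rw [crossMoment, ContinuousLinearMap.integral_comp_comm, h,
    ContinuousLinearMap.integral_comp_comm]
  · simp
  · simpa using integrable_resampleSq_mul μ hX hint j Finset.univ
  · refine integrable_sub_sq_mul_pow μ hX hint measurePreserving_fst ?_ measurePreserving_fst
    have := measurePreserving_fst.comp e
    simpa [Function.comp_def, swapOn_singleton_fst] using this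

include hX hint in
-- The exchange off T moves the mixed argument from the squared difference to the power, so that V,
-- evaluated at Z, can appear after summing over j.
lemma integral_piecewise_sq_mul_eq_crossMoment {j : κ} {T : Finset κ} (hj : j ∈ T) :
    ∫ x : (∀ j, E j) × (∀ j, E j), reTrace ι ((X (T.piecewise x.1 x.2) -
        X ((T.erase j).piecewise x.1 x.2)) ^ 2 * X x.1 ^ (2 * m))
          ∂(Measure.pi μ).prod (Measure.pi μ) =
      crossMoment μ m X j T := by
  have hmeas : StronglyMeasurable fun x : (∀ j, E j) × (∀ j, E j) =>
      (X (T.piecewise x.1 x.2) - X ((T.erase j).piecewise x.1 x.2)) ^ 2 * X x.1 ^ (2 * m) :=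
    (((hX.comp_measurable (measurable_piecewise_pair T)).sub
      (hX.comp_measurable (measurable_piecewise_pair (T.erase j)))).pow 2).mul
        ((hX.comp_measurable measurable_fst).pow _)
  rw [crossMoment, ContinuousLinearMap.integral_comp_comm, ContinuousLinearMap.integral_comp_comm,
    ← integral_update_sq_mul μ hX hint hj,
    ← integral_comp_of_stronglyMeasurable (measurePreserving_swapOn μ Tᶜ) hmeas]
  · simp only [piecewise_swapOn_compl, erase_piecewise_swapOn_compl hj]
    simp only [swapOn_compl_fst]
  · exact integrable_resampleSq_mul μ hX hint j T
  · exact integrable_sub_sq_mul_pow μ hX hint (measurePreserving_piecewise μ T)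
      (measurePreserving_piecewise μ _) measurePreserving_fst

include hX hH hint in
/-- Exchanging the coordinate `j` and the mean value trace inequality bound the contribution of one
step of the interpolation between `Z` and its independent copy. -/
lemma integral_pow_mul_step_le {j : κ} {T : Finset κ} (hj : j ∈ T) {s : ℝ} (hs : 0 < s) :
    ∫ x : (∀ j, E j) × (∀ j, E j), reTrace ι (X x.1 ^ (2 * m + 1) * (X (T.piecewise x.1 x.2) -
        X ((T.erase j).piecewise x.1 x.2))) ∂(Measure.pi μ).prod (Measure.pi μ) ≤
      (2 * m + 1) / 4 *
        (s * crossMoment μ m X j Finset.univ + s⁻¹ * crossMoment μ m X j T) := by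
  set ρ := (Measure.pi μ).prod (Measure.pi μ)
  have hsw := measurePreserving_swapOn μ {j}
  have hfst : MeasurePreserving (Prod.fst : (∀ j, E j) × (∀ j, E j) → _) ρ (Measure.pi μ) :=
    measurePreserving_fst
  have hup : MeasurePreserving
      (fun x : (∀ j, E j) × (∀ j, E j) => Function.update x.1 j (x.2 j)) ρ (Measure.pi μ) := by
    simpa [Function.comp_def, swapOn_singleton_fst] using hfst.comp hsw
  have hT := measurePreserving_piecewise μ T
  have hT' := measurePreserving_piecewise μ (T.erase j)
  have mX : ∀ {φ : (∀ j, E j) × (∀ j, E j) → ∀ j, E j}, MeasurePreserving φ ρ (Measure.pi μ) →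
      StronglyMeasurable fun x => X (φ x) := fun h => hX.comp_measurable h.measurable
  have c := (reTrace ι).continuous
  have exch : ∀ f : (∀ j, E j) × (∀ j, E j) → Matrix ι ι ℂ, StronglyMeasurable f →
      ∫ x, reTrace ι (f x) ∂ρ = ∫ x, reTrace ι (f (swapOn {j} x)) ∂ρ := fun f hf =>
    (integral_comp_of_stronglyMeasurable hsw (c.comp_stronglyMeasurable hf)).symm
  set D : (∀ j, E j) × (∀ j, E j) → Matrix ι ι ℂ := fun x =>
    X (T.piecewise x.1 x.2) - X ((T.erase j).piecewise x.1 x.2) with hD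
  set R : (∀ j, E j) × (∀ j, E j) → Matrix ι ι ℂ := fun x =>
    X x.1 - X (Function.update x.1 j (x.2 j)) with hR
  have hDs : ∀ x, D (swapOn {j} x) = -D x := fun x => by
    simp only [hD, piecewise_swapOn_singleton hj, erase_piecewise_swapOn_singleton hj, neg_sub]
  have hRs : ∀ x, R (swapOn {j} x) = -R x := fun x => by
    have h1 : Function.update (swapOn {j} x).1 j ((swapOn {j} x).2 j) = x.1 := by
      rw [← swapOn_singleton_fst, swapOn_swapOn]
    simp only [hR]
    rw [h1, swapOn_singleton_fst, neg_sub]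
  have mD : StronglyMeasurable D := (mX hT).sub (mX hT')
  have mR : StronglyMeasurable R := (mX hfst).sub (mX hup)
  have iFD : ∀ {φ : (∀ j, E j) × (∀ j, E j) → ∀ j, E j}, MeasurePreserving φ ρ (Measure.pi μ) →
      Integrable (fun x => X (φ x) ^ (2 * m + 1) * D x) ρ := fun h => by
    simp only [hD, mul_sub]
    exact (integrable_pow_mul μ hX hint h hT).sub (integrable_pow_mul μ hX hint h hT')
  have iD : ∀ {φ : (∀ j, E j) × (∀ j, E j) → ∀ j, E j}, MeasurePreserving φ ρ (Measure.pi μ) →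
      Integrable (fun x => reTrace ι (D x ^ 2 * X (φ x) ^ (2 * m))) ρ := fun h =>
    (reTrace ι).integrable_comp (integrable_sub_sq_mul_pow μ hX hint hT hT' h)
  have iR : ∀ {φ : (∀ j, E j) × (∀ j, E j) → ∀ j, E j}, MeasurePreserving φ ρ (Measure.pi μ) →
      Integrable (fun x => reTrace ι (R x ^ 2 * X (φ x) ^ (2 * m))) ρ := fun h =>
    (reTrace ι).integrable_comp (integrable_sub_sq_mul_pow μ hX hint hfst hup h)
  -- The exchange of j makes the step antisymmetric; hence twice the step is the integral bounded in
  -- `hmv`.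
  have hF : ∫ x, reTrace ι (X x.1 ^ (2 * m + 1) * D x) ∂ρ =
      ∫ x, -reTrace ι (X (Function.update x.1 j (x.2 j)) ^ (2 * m + 1) * D x) ∂ρ := by
    rw [exch (fun x => X x.1 ^ (2 * m + 1) * D x) (((mX hfst).pow _).mul mD)]
    simp only [hDs, swapOn_singleton_fst, mul_neg, map_neg]
  -- The squares are invariant under the exchange, so both powers contribute equally and the factor
  -- 2 cancels the half.
  have hD2 : ∫ x, reTrace ι (D x ^ 2 * X (Function.update x.1 j (x.2 j)) ^ (2 * m)) ∂ρ =
      ∫ x, reTrace ι (D x ^ 2 * X x.1 ^ (2 * m)) ∂ρ := by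
    rw [exch (fun x => D x ^ 2 * X x.1 ^ (2 * m)) ((mD.pow 2).mul ((mX hfst).pow _))]
    simp only [hDs, swapOn_singleton_fst, neg_sq]
  have hR2 : ∫ x, reTrace ι (R x ^ 2 * X (Function.update x.1 j (x.2 j)) ^ (2 * m)) ∂ρ =
      ∫ x, reTrace ι (R x ^ 2 * X x.1 ^ (2 * m)) ∂ρ := by
    rw [exch (fun x => R x ^ 2 * X x.1 ^ (2 * m)) ((mR.pow 2).mul ((mX hfst).pow _))]
    simp only [hRs, swapOn_singleton_fst, neg_sq]
  have iRR : Integrable (fun x => s * (reTrace ι (R x ^ 2 * X x.1 ^ (2 * m)) +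
      reTrace ι (R x ^ 2 * X (Function.update x.1 j (x.2 j)) ^ (2 * m)))) ρ :=
    ((iR hfst).add (iR hup)).const_mul s
  have iDD : Integrable (fun x => s⁻¹ * (reTrace ι (D x ^ 2 * X x.1 ^ (2 * m)) +
      reTrace ι (D x ^ 2 * X (Function.update x.1 j (x.2 j)) ^ (2 * m)))) ρ :=
    ((iD hfst).add (iD hup)).const_mul s⁻¹
  have hmv : ∫ x, (reTrace ι (X x.1 ^ (2 * m + 1) * D x) -
        reTrace ι (X (Function.update x.1 j (x.2 j)) ^ (2 * m + 1) * D x)) ∂ρ ≤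
      ∫ x, (2 * m + 1) / 4 *
        (s * (reTrace ι (R x ^ 2 * X x.1 ^ (2 * m)) +
            reTrace ι (R x ^ 2 * X (Function.update x.1 j (x.2 j)) ^ (2 * m))) +
          s⁻¹ * (reTrace ι (D x ^ 2 * X x.1 ^ (2 * m)) +
            reTrace ι (D x ^ 2 * X (Function.update x.1 j (x.2 j)) ^ (2 * m)))) ∂ρ := by
    refine integral_mono (((reTrace ι).integrable_comp (iFD hfst)).sub
      ((reTrace ι).integrable_comp (iFD hup)))
      ((iRR.add iDD).const_mul _) fun x => ?_
    have := reTrace_pow_sub_pow_mul_le (hH x.1) (hH (Function.update x.1 j (x.2 j)))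
      ((hH (T.piecewise x.1 x.2)).sub (hH ((T.erase j).piecewise x.1 x.2))) m hs
    rw [sub_mul, map_sub] at this
    exact this
  rw [integral_const_mul, integral_add iRR iDD, integral_const_mul, integral_const_mul,
    integral_add (iR hfst) (iR hup), integral_add (iD hfst) (iD hup), hR2, hD2,
    integral_sub ((reTrace ι).integrable_comp (iFD hfst)) ((reTrace ι).integrable_comp (iFD hup)),
    integral_update_sq_mul_eq_crossMoment μ hX hint,
    integral_piecewise_sq_mul_eq_crossMoment μ hX hint hj] at hmv
  rw [integral_neg] at hF
  linarith

end Resampling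

/-! ### Averaging over permutations. -/

section Permutations

variable {n : ℕ}

/-- The set of the first `k` values of the permutation `σ`. -/
def permInit (σ : Equiv.Perm (Fin n)) (k : ℕ) : Finset (Fin n) :=
  Finset.univ.filter fun i => (σ.symm i : ℕ) < k

lemma mem_permInit {σ : Equiv.Perm (Fin n)} {k : ℕ} {i : Fin n} :
    i ∈ permInit σ k ↔ (σ.symm i : ℕ) < k := by simp [permInit]

lemma permInit_zero (σ : Equiv.Perm (Fin n)) : permInit σ 0 = ∅ := by
  ext i; simp [mem_permInit]

lemma permInit_self (σ : Equiv.Perm (Fin n)) : permInit σ n = Finset.univ := by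
  ext i; simp [mem_permInit]

lemma apply_mem_permInit_succ (σ : Equiv.Perm (Fin n)) (k : Fin n) :
    σ k ∈ permInit σ (k + 1) := by simp [mem_permInit]

lemma permInit_succ_erase (σ : Equiv.Perm (Fin n)) (k : Fin n) :
    (permInit σ (k + 1)).erase (σ k) = permInit σ k := by
  ext i
  rw [Finset.mem_erase, mem_permInit, mem_permInit, Ne, ← Equiv.symm_apply_eq, Fin.ext_iff]
  omega

/-- The swap only rearranges the first k + 1 positions, so their set of values is unchanged. -/
lemma permInit_mul_swap (σ : Equiv.Perm (Fin n)) {k i : Fin n} (h : i ≤ k) :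
    permInit (σ * Equiv.swap i k) (k + 1) = permInit σ (k + 1) := by
  ext j
  rw [mem_permInit, mem_permInit]
  have : (σ * Equiv.swap i k).symm j = Equiv.swap i k (σ.symm j) := rfl
  rw [this, Equiv.swap_apply_def, Fin.le_def] at *
  split_ifs with h1 h2
  · rw [h1]; omega
  · rw [h2]; omega
  · rfl

/-- Averaging over permutations: a nonnegative quantity attached to `σ k`, invariant under
exchanging `k` with an element of `S`, is on average at most `1 / |S|` times the total. -/
lemma sum_perm_le {S : Finset (Fin n)} {k : Fin n} (hk : k ∈ S)
    (f : Fin n → Equiv.Perm (Fin n) → ℝ) (h0 : ∀ j σ, 0 ≤ f j σ)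
    (hswap : ∀ i ∈ S, ∀ j σ, f j (σ * Equiv.swap i k) = f j σ) {B : ℝ}
    (hB : ∀ σ, ∑ j, f j σ ≤ B) :
    ∑ σ, f (σ k) σ ≤ Fintype.card (Equiv.Perm (Fin n)) * B / S.card := by
  have hS : (0 : ℝ) < S.card := by exact_mod_cast Finset.card_pos.2 ⟨k, hk⟩
  rw [le_div_iff₀ hS]
  -- Reindexing by σ ↦ σ ∘ (i k) shows that every position in S has the same average.
  have h1 : ∀ i ∈ S, ∑ σ, f (σ i) σ = ∑ σ, f (σ k) σ := fun i hi => by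
    refine (Fintype.sum_equiv (Equiv.mulRight (Equiv.swap i k)) _ _ fun σ => ?_)
    rw [Equiv.coe_mulRight, hswap i hi, Equiv.Perm.mul_apply, Equiv.swap_apply_right]
  calc (∑ σ, f (σ k) σ) * S.card = ∑ i ∈ S, ∑ σ, f (σ i) σ := by
        rw [Finset.sum_congr rfl h1, Finset.sum_const, nsmul_eq_mul, mul_comm]
    _ = ∑ σ : Equiv.Perm (Fin n), ∑ i ∈ S, f (σ i) σ := Finset.sum_comm
    _ ≤ ∑ σ : Equiv.Perm (Fin n), B := by
        refine Finset.sum_le_sum fun σ _ => ?_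
        calc ∑ i ∈ S, f (σ i) σ ≤ ∑ i, f (σ i) σ :=
              Finset.sum_le_sum_of_subset_of_nonneg (Finset.subset_univ _) fun i _ _ => h0 _ _
          _ = ∑ j, f j σ := Equiv.sum_comp σ fun j => f j σ
          _ ≤ B := hB σ
    _ = _ := by rw [Finset.sum_const, nsmul_eq_mul, Finset.card_univ]

lemma sum_one_div_sqrt_le (n : ℕ) : ∑ k ∈ Finset.range n, 1 / √((k : ℝ) + 1) ≤ 2 * √n := by
  induction n with
  | zero => simp
  | succ n ih =>
    rw [Finset.sum_range_succ]
    have h1 : 0 < √((n : ℝ) + 1) := by positivity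
    have h2 : √((n : ℝ) + 1) * √((n : ℝ) + 1) = n + 1 := Real.mul_self_sqrt (by positivity)
    have h3 : √(n : ℝ) * √(n : ℝ) = n := Real.mul_self_sqrt (by positivity)
    -- Comparison with the increment of 2√x; equivalent to (√(n+1) - √n)² ≥ 0.
    have h4 : 1 / √((n : ℝ) + 1) ≤ 2 * √((n : ℝ) + 1) - 2 * √n := by
      rw [div_le_iff₀ h1]
      nlinarith [sq_nonneg (√((n : ℝ) + 1) - √n)]
    push_cast
    linarith

end Permutations

/-! ### The inequality under a finite moment of order 2m + 2. -/

section EfronStein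

open scoped ComplexOrder

variable {ι : Type*} [Fintype ι] [DecidableEq ι] {n : ℕ} {E : Fin n → Type*}
  [∀ j, MeasurableSpace (E j)] (μ : ∀ j, Measure (E j)) [∀ j, IsProbabilityMeasure (μ j)]
  {X : (∀ j, E j) → Matrix ι ι ℂ} {m : ℕ} (hX : StronglyMeasurable X)
  (hH : ∀ z, (X z).IsHermitian)
  (hint : Integrable (fun z => ‖X z‖ ^ (2 * m + 2)) (Measure.pi μ))

include hX hint in
-- The cross term vanishes because the second vector is independent of the first and X has mean
-- zero.
lemma integral_reTrace_pow_mul_sub (hmean : ∫ z, X z ∂Measure.pi μ = 0) :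
    ∫ x : (∀ j, E j) × (∀ j, E j), reTrace ι (X x.1 ^ (2 * m + 1) * (X x.1 - X x.2))
        ∂(Measure.pi μ).prod (Measure.pi μ) =
      ∫ z, reTrace ι (X z ^ (2 * m + 2)) ∂Measure.pi μ := by
  have hfst : MeasurePreserving (Prod.fst : (∀ j, E j) × (∀ j, E j) → _)
    ((Measure.pi μ).prod (Measure.pi μ)) (Measure.pi μ) := measurePreserving_fst
  have hsnd : MeasurePreserving (Prod.snd : (∀ j, E j) × (∀ j, E j) → _)
    ((Measure.pi μ).prod (Measure.pi μ)) (Measure.pi μ) := measurePreserving_snd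
  have i1 := (reTrace ι).integrable_comp (integrable_pow_mul μ hX hint hfst hfst)
  have i2 := (reTrace ι).integrable_comp (integrable_pow_mul μ hX hint hfst hsnd)
  have iX : Integrable X (Measure.pi μ) := by
    rw [← integrable_norm_iff hX.aestronglyMeasurable]
    simpa using integrable_norm_pow_of_exponent_le (k := 1) hX.aestronglyMeasurable
      (by omega) hint
  have h0 : ∫ x : (∀ j, E j) × (∀ j, E j), reTrace ι (X x.1 ^ (2 * m + 1) * X x.2)
      ∂(Measure.pi μ).prod (Measure.pi μ) = 0 := by
    rw [integral_prod _ i2]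
    refine integral_eq_zero_of_ae (ae_of_all _ fun z => ?_)
    have : Integrable (fun z' => X z ^ (2 * m + 1) * X z') (Measure.pi μ) := iX.const_mul _
    simp only
    rw [(reTrace ι).integral_comp_comm this, integral_const_mul_of_integrable iX, hmean]
    simp
  simp only [mul_sub, map_sub]
  rw [integral_sub i1 i2, h0, sub_zero, ← integral_comp_of_stronglyMeasurable hfst
    (stronglyMeasurable_reTrace_pow hX (2 * m + 2))]
  simp [pow_succ]

include hX hint in
/-- Telescoping along the order in which the permutation `σ` resamples the coordinates. -/
lemma integral_reTrace_pow_eq_sum (hmean : ∫ z, X z ∂Measure.pi μ = 0)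
    (σ : Equiv.Perm (Fin n)) :
    ∫ z, reTrace ι (X z ^ (2 * m + 2)) ∂Measure.pi μ =
      ∑ k : Fin n, ∫ x : (∀ j, E j) × (∀ j, E j), reTrace ι (X x.1 ^ (2 * m + 1) *
        (X ((permInit σ (k + 1)).piecewise x.1 x.2) -
          X (((permInit σ (k + 1)).erase (σ k)).piecewise x.1 x.2)))
            ∂(Measure.pi μ).prod (Measure.pi μ) := by
  rw [← integral_reTrace_pow_mul_sub μ hX hint hmean, ← integral_finsetSum]
  · refine integral_congr_ae (ae_of_all _ fun x => ?_)
    beta_reduce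
    rw [← map_sum, ← Finset.mul_sum]
    congr 2
    have he : ∀ k : Fin n, ((permInit σ (k + 1)).erase (σ k)).piecewise x.1 x.2 =
        (permInit σ k).piecewise x.1 x.2 := fun k => by
      ext i
      simp only [Finset.piecewise, permInit_succ_erase]
    simp only [he]
    rw [Fin.sum_univ_eq_sum_range (fun k => X ((permInit σ (k + 1)).piecewise x.1 x.2) -
      X ((permInit σ k).piecewise x.1 x.2)), Finset.sum_range_sub (fun k =>
      X ((permInit σ k).piecewise x.1 x.2)), permInit_zero, permInit_self,
      Finset.piecewise_univ, Finset.piecewise_empty]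
  · intro k _
    simp only [mul_sub]
    exact (reTrace ι).integrable_comp
      ((integrable_pow_mul μ hX hint measurePreserving_fst (measurePreserving_piecewise μ _)).sub
      (integrable_pow_mul μ hX hint measurePreserving_fst (measurePreserving_piecewise μ _)))

include hX hH hint in
-- The mean squares sum to 2V, so Young's inequality is applied to 2(2m+1) V and X(Z_T)². The result
-- does not depend on T, because Z_T has the law of Z.
lemma sum_crossMoment_le
    (hV : Integrable (fun z => reTrace ι (pointProxy μ X z ^ (m + 1))) (Measure.pi μ))
    (T : Finset (Fin n)) :
    (2 * m + 1) * ∑ j, crossMoment μ m X j T ≤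
      (2 * (2 * m + 1)) ^ (m + 1) *
          (∫ z, reTrace ι (pointProxy μ X z ^ (m + 1)) ∂Measure.pi μ) / (m + 1) +
        m / (m + 1) * ∫ z, reTrace ι (X z ^ (2 * m + 2)) ∂Measure.pi μ := by
  have hfst : MeasurePreserving (Prod.fst : (∀ j, E j) × (∀ j, E j) → _)
    ((Measure.pi μ).prod (Measure.pi μ)) (Measure.pi μ) := measurePreserving_fst
  have hT := measurePreserving_piecewise μ T
  have iM : Integrable (fun z => reTrace ι (X z ^ (2 * m + 2))) (Measure.pi μ) :=
    (reTrace ι).integrable_comp (integrable_matrix_pow hX hint)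
  have iC : ∀ j, Integrable (fun x : (∀ j, E j) × (∀ j, E j) => reTrace ι
      (resampleSq μ X j x.1 * X (T.piecewise x.1 x.2) ^ (2 * m)))
      ((Measure.pi μ).prod (Measure.pi μ)) := fun j =>
    (reTrace ι).integrable_comp (integrable_resampleSq_mul μ hX hint j T)
  have mV := stronglyMeasurable_pointProxy μ hX
  rw [← integral_comp_of_stronglyMeasurable hfst
    (stronglyMeasurable_reTrace_pow mV (m + 1)),
    ← integral_comp_of_stronglyMeasurable hT (stronglyMeasurable_reTrace_pow hX (2 * m + 2))]
  unfold crossMoment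
  rw [← integral_finsetSum _ fun j _ => iC j, ← integral_const_mul, ← integral_const_mul,
    ← integral_const_mul, ← integral_div, ← integral_add]
  rotate_left
  · exact ((hfst.integrable_comp_of_integrable hV).const_mul _).div_const _
  · exact (hT.integrable_comp_of_integrable iM).const_mul _
  refine integral_mono ((integrable_finsetSum _ fun j _ => iC j).const_mul _)
    ((((hfst.integrable_comp_of_integrable hV).const_mul _).div_const _).add
      ((hT.integrable_comp_of_integrable iM).const_mul _)) fun x => ?_
  have hA : ((2 * (2 * m + 1) : ℝ) • pointProxy μ X x.1).PosSemidef := by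
    rw [← Matrix.nonneg_iff_posSemidef]
    exact smul_nonneg (by positivity)
      (Matrix.nonneg_iff_posSemidef.2 (posSemidef_pointProxy μ hH _))
  have hy := reTrace_young hA (hH (T.piecewise x.1 x.2)).posSemidef_sq m
  rw [← pow_mul, ← pow_mul, smul_pow, map_smul, smul_eq_mul, mul_add_one 2 m] at hy
  refine le_trans (le_of_eq ?_) hy
  rw [pointProxy, smul_smul, smul_mul_assoc, map_smul, Finset.sum_mul, map_sum, smul_eq_mul]
  ring

include hX hH hint in
/-- The matrix polynomial Efron–Stein inequality for a centered function of independent variables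
with a finite moment of order `2m + 2`. -/
theorem integral_reTrace_pow_le (hmean : ∫ z, X z ∂Measure.pi μ = 0)
    (hV : Integrable (fun z => reTrace ι (pointProxy μ X z ^ (m + 1))) (Measure.pi μ)) :
    ∫ z, reTrace ι (X z ^ (2 * m + 2)) ∂Measure.pi μ ≤ (2 * (2 * m + 1)) ^ (m + 1) *
      ∫ z, reTrace ι (pointProxy μ X z ^ (m + 1)) ∂Measure.pi μ := by
  set M := ∫ z, reTrace ι (X z ^ (2 * m + 2)) ∂Measure.pi μ with hM
  set v := ∫ z, reTrace ι (pointProxy μ X z ^ (m + 1)) ∂Measure.pi μ with hv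
  set B := (2 * (2 * m + 1)) ^ (m + 1) * v / (m + 1) + m / (m + 1) * M with hB
  have hB0 : 0 ≤ B := by
    have hM0 : 0 ≤ M := integral_nonneg fun z =>
      reTrace_nonneg (by simpa [mul_add] using (hH z).posSemidef_pow_two_mul (m + 1))
    have hv0 : 0 ≤ v := integral_nonneg fun z =>
      reTrace_nonneg ((posSemidef_pointProxy μ hH z).pow _)
    positivity
  have hsum : ∀ T : Finset (Fin n), ∑ j, (2 * m + 1) * crossMoment μ m X j T ≤ B := fun T => by
    rw [← Finset.mul_sum]
    exact sum_crossMoment_le μ hX hH hint hV T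
  have hnn : ∀ j T, 0 ≤ (2 * m + 1) * crossMoment μ m X j T := fun j T =>
    mul_nonneg (by positivity) (crossMoment_nonneg μ hH j T)
  set N : ℝ := (Fintype.card (Equiv.Perm (Fin n)) : ℝ) with hN
  have hN0 : 0 < N := by rw [hN]; exact_mod_cast Fintype.card_pos
  have hMB : M ≤ B := by
    refine le_of_mul_le_mul_left ?_ hN0
    -- This weight balances s/n against s⁻¹/(k+1).
    set s : Fin n → ℝ := fun k => √(n / (k + 1)) with hs
    have hn0 : ∀ k : Fin n, (0 : ℝ) < n := fun k => by exact_mod_cast k.pos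
    have hs0 : ∀ k, 0 < s k := fun k => by
      have := hn0 k
      simp only [hs]; positivity
    calc N * M = ∑ σ : Equiv.Perm (Fin n), M := by
          rw [Finset.sum_const, nsmul_eq_mul, Finset.card_univ]
      _ ≤ ∑ σ : Equiv.Perm (Fin n), ∑ k : Fin n, (2 * m + 1) / 4 *
          (s k * crossMoment μ m X (σ k) Finset.univ +
            (s k)⁻¹ * crossMoment μ m X (σ k) (permInit σ (k + 1))) := by
          refine Finset.sum_le_sum fun σ _ => ?_
          rw [hM, integral_reTrace_pow_eq_sum μ hX hint hmean σ]
          exact Finset.sum_le_sum fun k _ => integral_pow_mul_step_le μ hX hH hint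
            (apply_mem_permInit_succ σ k) (hs0 k)
      _ = ∑ k : Fin n, 1 / 4 *
          (s k * (∑ σ : Equiv.Perm (Fin n), (2 * m + 1) * crossMoment μ m X (σ k) Finset.univ) +
            (s k)⁻¹ * ∑ σ : Equiv.Perm (Fin n),
              (2 * m + 1) * crossMoment μ m X (σ k) (permInit σ (k + 1))) := by
          rw [Finset.sum_comm]
          refine Finset.sum_congr rfl fun k _ => ?_
          rw [Finset.mul_sum, Finset.mul_sum, ← Finset.sum_add_distrib, Finset.mul_sum]
          exact Finset.sum_congr rfl fun σ _ => by ring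
      _ ≤ ∑ k : Fin n, 1 / 4 * (s k * (N * B / n) + (s k)⁻¹ * (N * B / (k + 1))) := by
          refine Finset.sum_le_sum fun k _ => ?_
          have h1 := sum_perm_le (Finset.mem_univ k)
            (fun j _ => (2 * m + 1) * crossMoment μ m X j Finset.univ)
            (fun j _ => hnn j _) (fun _ _ _ _ => rfl) (fun _ => hsum _)
          -- Here the set depends on σ, so only swaps among the positions up to k are allowed: the
          -- gain is 1/(k+1) instead of 1/n.
          have h2 := sum_perm_le (Finset.mem_Iic.2 (le_refl k))
            (fun j σ => (2 * m + 1) * crossMoment μ m X j (permInit σ (k + 1)))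
            (fun j _ => hnn j _)
            (fun i hi j σ => by rw [permInit_mul_swap σ (Finset.mem_Iic.1 hi)])
            (fun _ => hsum _)
          rw [Finset.card_univ, Fintype.card_fin] at h1
          rw [Fin.card_Iic] at h2
          push_cast at h2
          have := hs0 k
          gcongr
      _ = ∑ k : Fin n, N * B / (2 * √n) * (1 / √((k : ℝ) + 1)) := by
          refine Finset.sum_congr rfl fun k _ => ?_
          have h1 : 0 < √(n : ℝ) := Real.sqrt_pos.2 (hn0 k)
          have h2 : 0 < √((k : ℝ) + 1) := Real.sqrt_pos.2 (by positivity)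
          have e1 : √(n : ℝ) ^ 2 = n := Real.sq_sqrt (hn0 k).le
          have e2 : √((k : ℝ) + 1) ^ 2 = k + 1 := Real.sq_sqrt (by positivity)
          simp only [hs]
          rw [Real.sqrt_div (hn0 k).le]
          have key : 1 / 4 * (√(n : ℝ) / √((k : ℝ) + 1) * (N * B / √(n : ℝ) ^ 2) +
              (√(n : ℝ) / √((k : ℝ) + 1))⁻¹ * (N * B / √((k : ℝ) + 1) ^ 2)) =
              N * B / (2 * √n) * (1 / √((k : ℝ) + 1)) := by
            field_simp
            ring
          rwa [e1, e2] at key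
      _ = N * B / (2 * √n) * ∑ k ∈ Finset.range n, 1 / √((k : ℝ) + 1) := by
          rw [← Finset.mul_sum, Fin.sum_univ_eq_sum_range (fun k => 1 / √((k : ℝ) + 1))]
      _ ≤ N * B / (2 * √n) * (2 * √n) := by
          gcongr
          exact sum_one_div_sqrt_le n
      _ ≤ N * B := by
          -- The zero case is n = 0.
          rcases eq_or_ne (2 * √(n : ℝ)) 0 with h | h
          · rw [h, mul_zero]; positivity
          · rw [div_mul_cancel₀ _ h]
  have hm : (0 : ℝ) < m + 1 := by positivity
  -- The m copies of `M` on the right are absorbed, leaving a single one on the left.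
  have h1 : M * (m + 1) ≤ (2 * (2 * m + 1)) ^ (m + 1) * v + m * M := by
    calc M * (m + 1) ≤ B * (m + 1) := by gcongr
      _ = _ := by rw [hB]; field_simp
  linarith

end EfronStein

/-! ### Finiteness of the moment of X by truncation. -/

section Truncation

open scoped ComplexOrder

lemma integrable_of_lintegral_truncation_le {α : Type*} [MeasurableSpace α] {ν : Measure α}
    {g : α → ℝ} (hg : StronglyMeasurable g) (hg0 : ∀ x, 0 ≤ g x) (N : ℕ) (K : ENNReal)
    (hK : K ≠ ⊤) (h : ∀ R : ℕ, ∫⁻ x, ENNReal.ofReal (min (g x) R ^ N) ∂ν ≤ K) :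
    Integrable (fun x => g x ^ N) ν := by
  refine ⟨(hg.pow N).aestronglyMeasurable, ?_⟩
  rw [hasFiniteIntegral_iff_ofReal (ae_of_all _ fun x => pow_nonneg (hg0 x) N)]
  refine lt_of_le_of_lt ?_ hK.lt_top
  have ht : Filter.Tendsto (fun R : ℕ => ∫⁻ x, ENNReal.ofReal (min (g x) R ^ N) ∂ν)
      Filter.atTop (nhds (∫⁻ x, ENNReal.ofReal (g x ^ N) ∂ν)) := by
    refine lintegral_tendsto_of_tendsto_of_monotone (fun R => ?_) (ae_of_all _ fun x => ?_)
      (ae_of_all _ fun x => ?_)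
    · exact (((hg.measurable.min measurable_const).pow_const N).ennreal_ofReal).aemeasurable
    · intro a b hab
      refine ENNReal.ofReal_le_ofReal (pow_le_pow_left₀ (le_min (hg0 x) (by positivity)) ?_ N)
      exact min_le_min_left _ (by exact_mod_cast hab)
    · obtain ⟨R0, hR0⟩ := exists_nat_ge (g x)
      refine tendsto_const_nhds.congr' ?_
      filter_upwards [Filter.eventually_ge_atTop R0] with R hR
      rw [min_eq_left (hR0.trans (by exact_mod_cast hR))]
  exact le_of_tendsto' ht h

variable {ι : Type*} [Fintype ι] [DecidableEq ι] {n : ℕ} {E : Fin n → Type*}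
  [∀ j, MeasurableSpace (E j)] (μ : ∀ j, Measure (E j)) [∀ j, IsProbabilityMeasure (μ j)]
  {X : (∀ j, E j) → Matrix ι ι ℂ} {m : ℕ}

/-- Embeds scalar functions as multiples of the identity, so the matrix inequality also covers the
truncated norm. -/
lemma pointProxy_smul_one (f : (∀ j, E j) → ℝ) (c : ℝ) (z : ∀ j, E j) :
    pointProxy μ (fun z => (f z - c) • (1 : Matrix ι ι ℂ)) z =
      (1 / 2 * ∑ j, ∫ y, (f z - f (Function.update z j y)) ^ 2 ∂μ j) • (1 : Matrix ι ι ℂ) := by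
  rw [pointProxy, mul_smul, Finset.sum_smul]
  congr 1
  refine Finset.sum_congr rfl fun j _ => ?_
  rw [resampleSq, ← integral_smul_const]
  congr 1
  ext1 y
  rw [← sub_smul, sub_sub_sub_cancel_right, smul_pow, one_pow]

lemma reTrace_smul_one_pow (w : ℝ) (k : ℕ) :
    reTrace ι ((w • (1 : Matrix ι ι ℂ)) ^ k) = w ^ k * Fintype.card ι := by
  rw [smul_pow, one_pow, map_smul, smul_eq_mul, reTrace_apply, Matrix.trace_one]
  simp

/-- Norm and truncation are both 1-Lipschitz, and the squared operator norm is at most the trace of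
the square. -/
lemma sq_min_norm_sub_min_norm_le (A B : Matrix ι ι ℂ) (hA : A.IsHermitian) (hB : B.IsHermitian)
    (R : ℝ) : (min ‖A‖ R - min ‖B‖ R) ^ 2 ≤ reTrace ι ((A - B) ^ 2) := by
  refine le_trans ?_ (sq_norm_le_reTrace_sq (hA.sub hB))
  rw [← sq_abs]
  gcongr
  have h := abs_min_sub_min_le_max ‖A‖ R ‖B‖ R
  rw [sub_self, abs_zero, max_eq_left (abs_nonneg _)] at h
  exact h.trans (abs_norm_sub_norm_le _ _)

lemma ae_truncated_proxy_le (hX : StronglyMeasurable X) (hH : ∀ z, (X z).IsHermitian)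
    (h2 : Integrable (fun z => ‖X z‖ ^ 2) (Measure.pi μ)) (R : ℝ) :
    ∀ᵐ z ∂Measure.pi μ,
      1 / 2 * ∑ j, ∫ y, (min ‖X z‖ R - min ‖X (Function.update z j y)‖ R) ^ 2 ∂μ j ≤
        reTrace ι (pointProxy μ X z) := by
  have h := ae_all_iff.2 fun j => ae_integrable_resample_sq μ hX (m := 0) (by simpa using h2) j
  filter_upwards [h] with z hz
  rw [pointProxy, map_smul, map_sum, smul_eq_mul]
  refine mul_le_mul_of_nonneg_left (Finset.sum_le_sum fun j _ => ?_) (by norm_num)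
  rw [resampleSq, ← (reTrace ι).integral_comp_comm (hz j)]
  exact integral_mono_of_nonneg (ae_of_all _ fun y => sq_nonneg _)
    ((reTrace ι).integrable_comp (hz j))
    (ae_of_all _ fun y => sq_min_norm_sub_min_norm_le _ _ (hH _) (hH _) R)

/-- A moment of the variance proxy controls the moments of the truncated norm, uniformly in the
truncation level. -/
lemma integral_truncated_pow_le [Nonempty ι] (hX : StronglyMeasurable X)
    (hH : ∀ z, (X z).IsHermitian)
    (h2 : Integrable (fun z => ‖X z‖ ^ 2) (Measure.pi μ))
    (hV : Integrable (fun z => reTrace ι (pointProxy μ X z ^ (m + 1))) (Measure.pi μ)) (R : ℕ) :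
    ∫ z, (min ‖X z‖ R - ∫ z, min ‖X z‖ R ∂Measure.pi μ) ^ (2 * m + 2) ∂Measure.pi μ ≤
      (2 * (2 * m + 1)) ^ (m + 1) * ((Fintype.card ι : ℝ) ^ m *
        ∫ z, reTrace ι (pointProxy μ X z ^ (m + 1)) ∂Measure.pi μ) := by
  set g : (∀ j, E j) → ℝ := fun z => min ‖X z‖ R with hg
  set c := ∫ z, g z ∂Measure.pi μ with hc
  set w : (∀ j, E j) → ℝ := fun z =>
    1 / 2 * ∑ j, ∫ y, (g z - g (Function.update z j y)) ^ 2 ∂μ j with hw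
  have hcard : (0 : ℝ) < Fintype.card ι := by exact_mod_cast Fintype.card_pos
  have mg : StronglyMeasurable g :=
    (hX.norm.measurable.min measurable_const).stronglyMeasurable
  have hgb : ∀ z, |g z| ≤ R := fun z => by
    rw [abs_of_nonneg (le_min (norm_nonneg _) (by positivity))]
    exact min_le_right _ _
  have ig : Integrable g (Measure.pi μ) :=
    (integrable_const (R : ℝ)).mono' mg.aestronglyMeasurable (ae_of_all _ hgb)
  have mY : StronglyMeasurable fun z => (g z - c) • (1 : Matrix ι ι ℂ) :=
    (mg.sub stronglyMeasurable_const).smul_const _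
  have hYH : ∀ z, ((g z - c) • (1 : Matrix ι ι ℂ)).IsHermitian := fun z => by
    rw [Matrix.IsHermitian, Matrix.conjTranspose_smul, Matrix.conjTranspose_one, star_trivial]
  have iY : Integrable (fun z => ‖(g z - c) • (1 : Matrix ι ι ℂ)‖ ^ (2 * m + 2))
      (Measure.pi μ) := by
    refine (integrable_const (((R + |c|) * ‖(1 : Matrix ι ι ℂ)‖) ^ (2 * m + 2))).mono'
      (mY.norm.pow _).aestronglyMeasurable (ae_of_all _ fun z => ?_)
    rw [Real.norm_of_nonneg (by positivity), norm_smul]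
    gcongr
    exact (norm_sub_le _ _).trans (add_le_add (hgb z) le_rfl)
  have hmean : ∫ z, (g z - c) • (1 : Matrix ι ι ℂ) ∂Measure.pi μ = 0 := by
    rw [integral_smul_const, integral_sub ig (integrable_const _)]
    simp [hc]
  have hw0 : ∀ z, 0 ≤ w z := fun z =>
    mul_nonneg (by norm_num) (Finset.sum_nonneg fun j _ => integral_nonneg fun y => sq_nonneg _)
  have hproxy : ∀ z, reTrace ι (pointProxy μ (fun z => (g z - c) • (1 : Matrix ι ι ℂ)) z ^ (m + 1))
      = w z ^ (m + 1) * Fintype.card ι := fun z => by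
    rw [pointProxy_smul_one, reTrace_smul_one_pow]
  have hle : ∀ᵐ z ∂Measure.pi μ, w z ^ (m + 1) * Fintype.card ι ≤
      Fintype.card ι * ((Fintype.card ι : ℝ) ^ m * reTrace ι (pointProxy μ X z ^ (m + 1))) := by
    filter_upwards [ae_truncated_proxy_le μ hX hH h2 R] with z hz
    rw [mul_comm]
    gcongr
    exact (pow_le_pow_left₀ (hw0 z) hz _).trans (reTrace_pow_le (posSemidef_pointProxy μ hH z) m)
  have iV : Integrable (fun z => reTrace ι
      (pointProxy μ (fun z => (g z - c) • (1 : Matrix ι ι ℂ)) z ^ (m + 1))) (Measure.pi μ) := by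
    refine ((hV.const_mul ((Fintype.card ι : ℝ) ^ m)).const_mul (Fintype.card ι : ℝ)).mono'
      (stronglyMeasurable_reTrace_pow (stronglyMeasurable_pointProxy μ mY) _).aestronglyMeasurable
      ?_
    filter_upwards [hle] with z hz
    rw [hproxy, Real.norm_of_nonneg (mul_nonneg (pow_nonneg (hw0 z) _) hcard.le)]
    exact hz
  have key := integral_reTrace_pow_le μ mY hYH iY hmean iV
  simp only [reTrace_smul_one_pow] at key
  rw [integral_mul_const] at key
  have h3 : ∫ z, reTrace ι (pointProxy μ (fun z => (g z - c) • (1 : Matrix ι ι ℂ)) z ^ (m + 1))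
      ∂Measure.pi μ ≤ Fintype.card ι * ((Fintype.card ι : ℝ) ^ m *
        ∫ z, reTrace ι (pointProxy μ X z ^ (m + 1)) ∂Measure.pi μ) := by
    rw [← integral_const_mul, ← integral_const_mul]
    refine integral_mono_ae iV ((hV.const_mul _).const_mul _) ?_
    filter_upwards [hle] with z hz
    rw [hproxy]
    exact hz
  -- The trace of the identity gives one factor `Fintype.card ι` on each side.
  refine le_of_mul_le_mul_right ?_ hcard
  calc _ ≤ _ := key
    _ ≤ (2 * (2 * m + 1)) ^ (m + 1) * (Fintype.card ι * ((Fintype.card ι : ℝ) ^ m *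
        ∫ z, reTrace ι (pointProxy μ X z ^ (m + 1)) ∂Measure.pi μ)) := by gcongr
    _ = _ := by ring

/-- If the variance proxy has a finite moment of order `m + 1`, then the norm has a finite moment
of order `2m + 2`. -/
lemma integrable_norm_pow_of_integrable_proxy (hX : StronglyMeasurable X)
    (hH : ∀ z, (X z).IsHermitian)
    (h2 : Integrable (fun z => ‖X z‖ ^ 2) (Measure.pi μ))
    (hV : Integrable (fun z => reTrace ι (pointProxy μ X z ^ (m + 1))) (Measure.pi μ)) :
    Integrable (fun z => ‖X z‖ ^ (2 * m + 2)) (Measure.pi μ) := by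
  rcases isEmpty_or_nonempty ι with hι | hι
  · have : ∀ z, X z = 0 := fun z => Subsingleton.elim _ _
    simp [this]
  have i1 : Integrable (fun z => ‖X z‖) (Measure.pi μ) := by
    simpa using integrable_norm_pow_of_exponent_le (k := 1) hX.aestronglyMeasurable
      (by norm_num) h2
  set K := (2 * (2 * m + 1)) ^ (m + 1) * ((Fintype.card ι : ℝ) ^ m *
        ∫ z, reTrace ι (pointProxy μ X z ^ (m + 1)) ∂Measure.pi μ) with hK
  set c := ∫ z, ‖X z‖ ∂Measure.pi μ with hc
  refine integrable_of_lintegral_truncation_le hX.norm (fun _ => norm_nonneg _) _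
    (ENNReal.ofReal (2 ^ (2 * m + 2) * (K + c ^ (2 * m + 2)))) ENNReal.ofReal_ne_top fun R => ?_
  have hR := integral_truncated_pow_le μ hX hH h2 hV R
  set g : (∀ j, E j) → ℝ := fun z => min ‖X z‖ R with hg
  have mg : StronglyMeasurable g :=
    (hX.norm.measurable.min measurable_const).stronglyMeasurable
  have hg0 : ∀ z, 0 ≤ g z := fun z => le_min (norm_nonneg _) (by positivity)
  have hgb : ∀ z, ‖g z‖ ≤ R := fun z => by
    rw [Real.norm_of_nonneg (hg0 z)]
    exact min_le_right _ _
  have ig : Integrable g (Measure.pi μ) :=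
    (integrable_const (R : ℝ)).mono' mg.aestronglyMeasurable (ae_of_all _ hgb)
  set b := ∫ z, g z ∂Measure.pi μ with hb
  have hb0 : 0 ≤ b := integral_nonneg hg0
  -- The truncated means are bounded by E‖X‖ for all R, so the centering can be undone at a cost
  -- independent of R.
  have hbc : b ≤ c := integral_mono ig i1 fun z => min_le_left _ _
  have igN : Integrable (fun z => g z ^ (2 * m + 2)) (Measure.pi μ) := by
    refine (integrable_const ((R : ℝ) ^ (2 * m + 2))).mono' (mg.pow _).aestronglyMeasurable
      (ae_of_all _ fun z => ?_)
    rw [norm_pow]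
    exact pow_le_pow_left₀ (norm_nonneg _) (hgb z) _
  have igb : Integrable (fun z => (g z - b) ^ (2 * m + 2)) (Measure.pi μ) := by
    refine (integrable_const ((R + b : ℝ) ^ (2 * m + 2))).mono'
      ((mg.sub stronglyMeasurable_const).pow _).aestronglyMeasurable
      (ae_of_all _ fun z => ?_)
    rw [norm_pow]
    refine pow_le_pow_left₀ (norm_nonneg _) ((norm_sub_le _ _).trans (add_le_add (hgb z) ?_)) _
    rw [Real.norm_of_nonneg hb0]
  rw [← ofReal_integral_eq_lintegral_ofReal igN (ae_of_all _ fun z => pow_nonneg (hg0 z) _)]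
  refine ENNReal.ofReal_le_ofReal ?_
  have heven : ∀ x : ℝ, |x| ^ (2 * m + 2) = x ^ (2 * m + 2) := fun x =>
    Even.pow_abs ⟨m + 1, by ring⟩ x
  calc ∫ z, g z ^ (2 * m + 2) ∂Measure.pi μ ≤
      ∫ z, 2 ^ (2 * m + 2) * ((g z - b) ^ (2 * m + 2) + c ^ (2 * m + 2)) ∂Measure.pi μ := by
        refine integral_mono igN ((igb.add (integrable_const _)).const_mul _) fun z => ?_
        have h1 : g z ≤ 2 * max |g z - b| c := by
          linarith [le_max_left |g z - b| c, le_max_right |g z - b| c, le_abs_self (g z - b)]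
        calc g z ^ (2 * m + 2) ≤ (2 * max |g z - b| c) ^ (2 * m + 2) :=
              pow_le_pow_left₀ (hg0 z) h1 _
          _ ≤ 2 ^ (2 * m + 2) * (|g z - b| ^ (2 * m + 2) + c ^ (2 * m + 2)) := by
              rw [mul_pow]
              gcongr
              have hc0 : 0 ≤ c := hb0.trans hbc
              rcases max_choice |g z - b| c with h | h <;> rw [h]
              · linarith [pow_nonneg hc0 (2 * m + 2)]
              · linarith [pow_nonneg (abs_nonneg (g z - b)) (2 * m + 2)]
          _ = _ := by rw [heven]
    _ = 2 ^ (2 * m + 2) * (∫ z, (g z - b) ^ (2 * m + 2) ∂Measure.pi μ + c ^ (2 * m + 2)) := by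
        rw [integral_const_mul, integral_add igb (integrable_const _)]
        simp
    _ ≤ _ := by gcongr

end Truncation

/-! ### Schatten norms as traces of powers. -/

section Schatten

open scoped ComplexOrder

variable {d : ℕ}

lemma schattenNorm_pow {p : ℕ} (hp : p ≠ 0) (B : Matrix (Fin d) (Fin d) ℂ) :
    schattenNorm p B ^ p = reTrace (Fin d) (CFC.abs B ^ p) := by
  have h0 : (0 : Matrix (Fin d) (Fin d) ℂ) ≤ CFC.abs B := CFC.abs_nonneg B
  rw [schattenNorm, CFC.rpow_natCast _ _ h0, ← reTrace_apply, one_div]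
  exact Real.rpow_inv_natCast_pow
    (reTrace_nonneg ((Matrix.nonneg_iff_posSemidef.1 h0).pow p)) hp

lemma schattenNorm_pow_of_posSemidef {p : ℕ} (hp : p ≠ 0) {B : Matrix (Fin d) (Fin d) ℂ}
    (hB : B.PosSemidef) : schattenNorm p B ^ p = reTrace (Fin d) (B ^ p) := by
  rw [schattenNorm_pow hp, CFC.abs_of_nonneg B (Matrix.nonneg_iff_posSemidef.2 hB)]

/-- An even power involves only |B|² = B*B = B², so no sign condition on B is needed. -/
lemma schattenNorm_two_mul_pow {p : ℕ} (hp : p ≠ 0) {B : Matrix (Fin d) (Fin d) ℂ}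
    (hB : B.IsHermitian) :
    schattenNorm (2 * p) B ^ (2 * p) = reTrace (Fin d) (B ^ (2 * p)) := by
  have h := schattenNorm_pow (mul_ne_zero two_ne_zero hp) B
  push_cast at h
  rw [h, pow_mul, CFC.abs_sq, show star B = B from hB, ← sq, ← pow_mul]

end Schatten

/-! ### From the probability space to the product law. -/

section Transfer

open scoped ComplexOrder

variable {n d : ℕ} {Ω : Type*} [MeasurableSpace Ω] {P : Measure Ω} [IsProbabilityMeasure P]
  {E : Fin n → Type*} [∀ j, MeasurableSpace (E j)] {Z Z' : ∀ j, Ω → E j}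
  {H : (∀ j, E j) → Matrix (Fin d) (Fin d) ℂ}

lemma measurable_randomVector (hZ : ∀ j, Measurable (Z j)) : Measurable (randomVector Z) :=
  measurable_pi_lambda _ hZ

lemma measurePreserving_randomVector (hZ : ∀ j, Measurable (Z j)) (hindep : iIndepFun Z P) :
    MeasurePreserving (randomVector Z) P (Measure.pi fun j => P.map (Z j)) :=
  ⟨measurable_randomVector hZ,
    (iIndepFun_iff_map_fun_eq_pi_map fun j => (hZ j).aemeasurable).1 hindep⟩

lemma measurePreserving_randomVector_prodMk (hZ : ∀ j, Measurable (Z j))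
    (hZ' : ∀ j, Measurable (Z' j)) (hindep : iIndepFun Z P) (j : Fin n)
    (hcopy_indep : IndepFun (Z' j) (randomVector Z) P)
    (hcopy_law : IdentDistrib (Z' j) (Z j) P P) :
    MeasurePreserving (fun ω => (randomVector Z ω, Z' j ω)) P
      ((Measure.pi fun j => P.map (Z j)).prod (P.map (Z j))) := by
  have hm := measurable_randomVector hZ
  refine ⟨hm.prodMk (hZ' j), ?_⟩
  rw [(indepFun_iff_map_prod_eq_prod_map_map hm.aemeasurable (hZ' j).aemeasurable).1
    hcopy_indep.symm, (measurePreserving_randomVector hZ hindep).map_eq, hcopy_law.map_eq]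

/-- The adjoint is a continuous real-linear equivalence, so it commutes with the integral without an
integrability assumption. -/
lemma isHermitian_integral {f : Ω → Matrix (Fin d) (Fin d) ℂ} (hf : ∀ ω, (f ω).IsHermitian) :
    (∫ ω, f ω ∂P).IsHermitian := by
  have h := (starL' ℝ : Matrix (Fin d) (Fin d) ℂ ≃L[ℝ] Matrix (Fin d) (Fin d) ℂ).integral_comp_comm
    (μ := P) f
  have h2 : ∀ ω, (starL' ℝ : Matrix (Fin d) (Fin d) ℂ ≃L[ℝ] Matrix (Fin d) (Fin d) ℂ) (f ω) = f ω :=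
    fun ω => hf ω
  simp only [h2] at h
  exact h.symm

lemma varianceProxy_ae_eq (hZ : ∀ j, Measurable (Z j)) (hZ' : ∀ j, Measurable (Z' j))
    (hindep : iIndepFun Z P) (hcopy_indep : ∀ j, IndepFun (Z' j) (randomVector Z) P)
    (hcopy_law : ∀ j, IdentDistrib (Z' j) (Z j) P P) (hH : StronglyMeasurable H)
    (h2 : Integrable (fun z => ‖centeredMatrix P Z H z‖ ^ 2) (Measure.pi fun j => P.map (Z j))) :
    varianceProxy P Z Z' H =ᵐ[P] fun ω =>
      pointProxy (fun j => P.map (Z j)) (centeredMatrix P Z H) (randomVector Z ω) := by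
  have : ∀ j, IsProbabilityMeasure (P.map (Z j)) := fun j =>
    Measure.isProbabilityMeasure_map (hZ j).aemeasurable
  have hX : StronglyMeasurable (centeredMatrix P Z H) := hH.sub stronglyMeasurable_const
  have hmp := measurePreserving_randomVector hZ hindep
  have h : ∀ j, P[fun ω' => (centeredMatrix P Z H (randomVector Z ω') -
      centeredMatrix P Z H (resampledVector Z Z' j ω')) ^ 2 |
      MeasurableSpace.comap (randomVector Z) MeasurableSpace.pi] =ᵐ[P]
      fun ω => resampleSq (fun j => P.map (Z j)) (centeredMatrix P Z H) j (randomVector Z ω) := by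
    intro j
    have hi := integrable_sub_sq_mul_pow (m := 0) (fun j => P.map (Z j)) hX (by simpa using h2)
      (measurePreserving_fst (μ := Measure.pi fun j => P.map (Z j)) (ν := P.map (Z j)))
      (measurePreserving_update (fun j => P.map (Z j)) j) measurePreserving_fst
    simp only [mul_zero, pow_zero, mul_one] at hi
    exact condExp_comap_ae_eq_integral hmp
      (measurePreserving_randomVector_prodMk hZ hZ' hindep j (hcopy_indep j) (hcopy_law j)) hi
      (((hX.comp_measurable measurable_fst).sub
        (hX.comp_measurable (measurable_update_pair j))).pow 2)
  filter_upwards [ae_all_iff.2 h] with ω hω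
  simp only [varianceProxy, pointProxy, hω]

lemma lintegral_sq_enorm_lt_top_iff {α F : Type*} [MeasurableSpace α] [NormedAddCommGroup F]
    {ν : Measure α} {f : α → F} (hf : StronglyMeasurable f) :
    ∫⁻ x, ‖f x‖ₑ ^ 2 ∂ν < ⊤ ↔ Integrable (fun x => ‖f x‖ ^ 2) ν := by
  have hm : AEStronglyMeasurable (fun x => ‖f x‖ ^ 2) ν := (hf.norm.pow 2).aestronglyMeasurable
  rw [Integrable, and_iff_right hm, hasFiniteIntegral_iff_enorm]
  simp

/-- Truncation turns finiteness of the proxy moment into the integrability that the real-valued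
inequality requires. -/
theorem lintegral_reTrace_pow_le {E : Fin n → Type*} [∀ j, MeasurableSpace (E j)]
    (μ : ∀ j, Measure (E j)) [∀ j, IsProbabilityMeasure (μ j)]
    {X : (∀ j, E j) → Matrix (Fin d) (Fin d) ℂ} (hX : StronglyMeasurable X)
    (hH : ∀ z, (X z).IsHermitian) (h2 : Integrable (fun z => ‖X z‖ ^ 2) (Measure.pi μ))
    (hmean : ∫ z, X z ∂Measure.pi μ = 0) (m : ℕ)
    (hV : ∫⁻ z, ENNReal.ofReal (reTrace (Fin d) (pointProxy μ X z ^ (m + 1))) ∂Measure.pi μ ≠ ⊤) :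
    ∫⁻ z, ENNReal.ofReal (reTrace (Fin d) (X z ^ (2 * (m + 1)))) ∂Measure.pi μ ≤
      ENNReal.ofReal ((2 * (2 * m + 1)) ^ (m + 1)) *
        ∫⁻ z, ENNReal.ofReal (reTrace (Fin d) (pointProxy μ X z ^ (m + 1))) ∂Measure.pi μ := by
  have hV0 : ∀ z, 0 ≤ reTrace (Fin d) (pointProxy μ X z ^ (m + 1)) := fun z =>
    reTrace_nonneg ((posSemidef_pointProxy μ hH z).pow _)
  have iV : Integrable (fun z => reTrace (Fin d) (pointProxy μ X z ^ (m + 1))) (Measure.pi μ) :=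
    ⟨(stronglyMeasurable_reTrace_pow (stronglyMeasurable_pointProxy μ hX) _).aestronglyMeasurable,
      (hasFiniteIntegral_iff_ofReal (ae_of_all _ hV0)).2 hV.lt_top⟩
  have hint := integrable_norm_pow_of_integrable_proxy μ hX hH h2 iV
  have iX : Integrable (fun z => reTrace (Fin d) (X z ^ (2 * (m + 1)))) (Measure.pi μ) :=
    (reTrace (Fin d)).integrable_comp (integrable_matrix_pow hX hint)
  rw [← ofReal_integral_eq_lintegral_ofReal iX (ae_of_all _ fun z =>
      reTrace_nonneg ((hH z).posSemidef_pow_two_mul _)),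
    ← ofReal_integral_eq_lintegral_ofReal iV (ae_of_all _ hV0),
    ← ENNReal.ofReal_mul (by positivity)]
  exact ENNReal.ofReal_le_ofReal (integral_reTrace_pow_le μ hX hH hint hmean iV)

lemma integral_centeredMatrix (hmp : MeasurePreserving (randomVector Z) P
      (Measure.pi fun j => P.map (Z j))) [∀ j, IsProbabilityMeasure (P.map (Z j))]
    (hH : StronglyMeasurable H)
    (h2 : Integrable (fun z => ‖centeredMatrix P Z H z‖ ^ 2) (Measure.pi fun j => P.map (Z j))) :
    ∫ z, centeredMatrix P Z H z ∂(Measure.pi fun j => P.map (Z j)) = 0 := by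
  have hX : StronglyMeasurable (centeredMatrix P Z H) := hH.sub stronglyMeasurable_const
  have iX : Integrable (centeredMatrix P Z H) (Measure.pi fun j => P.map (Z j)) := by
    rw [← integrable_norm_iff hX.aestronglyMeasurable]
    simpa using integrable_norm_pow_of_exponent_le (k := 1) hX.aestronglyMeasurable
      (by norm_num) h2
  have iH : Integrable H (Measure.pi fun j => P.map (Z j)) := by
    have := iX.add (integrable_const (∫ ω, H (randomVector Z ω) ∂P))
    refine this.congr (ae_of_all _ fun z => ?_)
    simp [centeredMatrix]
  simp only [centeredMatrix]
  rw [integral_sub iH (integrable_const _), integral_comp_of_stronglyMeasurable hmp hH]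
  simp

end Transfer

/-! ### The matrix polynomial Efron–Stein inequality. -/

theorem theorem4p1 {n d : ℕ} {Ω : Type*} [MeasurableSpace Ω]
    (P : Measure Ω) [IsProbabilityMeasure P]
    {E : Fin n → Type*} [∀ j, TopologicalSpace (E j)] [∀ j, PolishSpace (E j)]
    [∀ j, MeasurableSpace (E j)] [∀ j, BorelSpace (E j)]
    (Z Z' : ∀ j, Ω → E j)
    (hZ : ∀ j, Measurable (Z j)) (hZ' : ∀ j, Measurable (Z' j))
    (hindep : iIndepFun Z P)
    (hcopy_indep : ∀ j, IndepFun (Z' j) (randomVector Z) P)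
    (hcopy_law : ∀ j, IdentDistrib (Z' j) (Z j) P P)
    (H : (∀ j, E j) → Matrix (Fin d) (Fin d) ℂ)
    (hH : StronglyMeasurable H) (hHerm : ∀ z, (H z).IsHermitian)
    (hL2 : ∫⁻ ω, ‖centeredMatrix P Z H (randomVector Z ω)‖ₑ ^ 2 ∂P < ⊤)
    (p : ℕ) (hp : 1 ≤ p) :
    (∫⁻ ω, ENNReal.ofReal
        (schattenNorm (2 * p) (centeredMatrix P Z H (randomVector Z ω)) ^ (2 * p)) ∂P)
          ^ (1 / (2 * p) : ℝ) ≤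
      ENNReal.ofReal √(2 * (2 * p - 1)) *
        (∫⁻ ω, ENNReal.ofReal (schattenNorm p (varianceProxy P Z Z' H ω) ^ p) ∂P)
          ^ (1 / (2 * p) : ℝ) := by
  have hprob : ∀ j, IsProbabilityMeasure (P.map (Z j)) := fun j =>
    Measure.isProbabilityMeasure_map (hZ j).aemeasurable
  set X := centeredMatrix P Z H with hXdef
  set μ : ∀ j, Measure (E j) := fun j => P.map (Z j) with hμ
  have hmp : MeasurePreserving (randomVector Z) P (Measure.pi μ) :=
    measurePreserving_randomVector hZ hindep
  have hX : StronglyMeasurable X := hH.sub stronglyMeasurable_const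
  have hXH : ∀ z, (X z).IsHermitian := fun z =>
    (hHerm z).sub (isHermitian_integral fun ω => hHerm _)
  have h2 : Integrable (fun z => ‖X z‖ ^ 2) (Measure.pi μ) := by
    rw [← lintegral_sq_enorm_lt_top_iff hX, ← hmp.lintegral_comp (hX.enorm.pow_const 2)]
    exact hL2
  have hmean : ∫ z, X z ∂Measure.pi μ = 0 := integral_centeredMatrix hmp hH h2
  have hp0 : p ≠ 0 := by omega
  have hleft : ∫⁻ ω, ENNReal.ofReal (schattenNorm (2 * p) (X (randomVector Z ω)) ^ (2 * p)) ∂P =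
      ∫⁻ z, ENNReal.ofReal (reTrace (Fin d) (X z ^ (2 * p))) ∂Measure.pi μ := by
    rw [← hmp.lintegral_comp (stronglyMeasurable_reTrace_pow hX _).measurable.ennreal_ofReal]
    simp only [schattenNorm_two_mul_pow hp0 (hXH _)]
  have hright : ∫⁻ ω, ENNReal.ofReal (schattenNorm p (varianceProxy P Z Z' H ω) ^ p) ∂P =
      ∫⁻ z, ENNReal.ofReal (reTrace (Fin d) (pointProxy μ X z ^ p)) ∂Measure.pi μ := by
    rw [← hmp.lintegral_comp (stronglyMeasurable_reTrace_pow
      (stronglyMeasurable_pointProxy μ hX) _).measurable.ennreal_ofReal]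
    refine lintegral_congr_ae ?_
    filter_upwards [varianceProxy_ae_eq hZ hZ' hindep hcopy_indep hcopy_law hH h2] with ω hω
    rw [hω, schattenNorm_pow_of_posSemidef hp0 (posSemidef_pointProxy μ hXH _)]
  rw [hleft, hright]
  obtain ⟨m, rfl⟩ : ∃ m, p = m + 1 := ⟨p - 1, by omega⟩
  have hq : (0 : ℝ) < 2 * (2 * ((m + 1 : ℕ) : ℝ) - 1) := by
    push_cast
    linarith [(Nat.cast_nonneg m : (0 : ℝ) ≤ m)]
  have hexp : (0 : ℝ) < 1 / (2 * ((m + 1 : ℕ) : ℝ)) := by positivity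
  -- If the proxy moment is infinite, so is the right side, because the constant is positive.
  by_cases hV : ∫⁻ z, ENNReal.ofReal (reTrace (Fin d) (pointProxy μ X z ^ (m + 1)))
      ∂Measure.pi μ = ⊤
  · rw [hV, ENNReal.top_rpow_of_pos hexp, ENNReal.mul_top]
    · exact le_top
    · exact (ENNReal.ofReal_pos.2 (Real.sqrt_pos.2 hq)).ne'
  · have key := lintegral_reTrace_pow_le μ hX hXH h2 hmean m hV
    have e : (2 * (2 * (m : ℝ) + 1)) = 2 * (2 * ((m + 1 : ℕ) : ℝ) - 1) := by push_cast; ring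
    have hc : ENNReal.ofReal ((2 * (2 * ((m + 1 : ℕ) : ℝ) - 1)) ^ (m + 1)) ^
        (1 / (2 * ((m + 1 : ℕ) : ℝ))) =
        ENNReal.ofReal √(2 * (2 * ((m + 1 : ℕ) : ℝ) - 1)) := by
      rw [ENNReal.ofReal_rpow_of_pos (pow_pos hq _), ← Real.rpow_natCast, ← Real.rpow_mul hq.le,
        Real.sqrt_eq_rpow]
      congr 2
      field_simp
    rw [e] at key
    calc _ ≤ _ := ENNReal.rpow_le_rpow key hexp.le
      _ = _ := by rw [ENNReal.mul_rpow_of_nonneg _ _ hexp.le, hc]
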